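/- Theorem 4. Consider $\min_{x\in\mathbb R^d}\{P(x):=f(x)+\psi(x)\}$, $f:=\frac1n\sum_{i=1}^n f_i$, $n\ge 1$, where each $f_i:\mathbb R^d\to\mathbb R$ is convex and differentiable with $L$-Lipschitz gradient ($L>0$), $f$ is $\mu$-strongly convex ($\mu>0$), and $\psi:\mathbb R^d\to\mathbb R\cup\{+\infty\}$ is proper, convex and lower semicontinuous. Let $x^*$ be the minimizer of $P$. Let $\omega\ge 0$. A randomized map $\mathcal C:\mathbb R^d\to\mathbb R^d$ is an $\omega$-compression operator if $\mathbb E[\mathcal C(x)]=x$ and $\mathbb E\|\mathcal C(x)-x\|^2\le\omega\|x\|^2$ for all $x$. ADIANA with parameters $\eta,\theta_1,\theta_2,\alpha,\beta,\gamma,p$ starts from $x^0$ with $\psi(x^0)<\infty$ and arbitrary shifts $h_1^0,\dots,h_n^0\in\mathbb R^d$, puts $z^0=y^0=w^0=x^0$, $h^0=\frac1n\sum_i h_i^0$, and for $k=0,1,2,\dots$ computes $$x^k=\theta_1z^k+\theta_2w^k+(1-\theta_1-\theta_2)y^k,\qquad g^k=\frac1n\sum_{i=1}^n\mathcal C_i^k(\nabla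 f_i(x^k)-h_i^k)+h^k,$$ $$h_i^{k+1}=h_i^k+\alpha\,\mathcal C_i^k(\nabla f_i(w^k)-h_i^k),\qquad h^{k+1}=h^k+\alpha\frac1n\sum_{i=1}^n\mathcal C_i^k(\nabla f_i(w^k)-h_i^k),$$ $$y^{k+1}=\mathrm{prox}_{\eta\psi}(x^k-\eta g^k),\qquad z^{k+1}=\beta z^k+(1-\beta)x^k+\frac\gamma\eta(y^{k+1}-x^k),$$ and $w^{k+1}=y^k$ with probability $p$, $w^{k+1}=w^k$ with probability $1-p$. Here $\mathrm{prox}_{\eta\psi}(v)=\arg\min_u\{\psi(u)+\frac1{2\eta}\|u-v\|^2\}$, all $\mathcal C_i^k$ are $\omega$-compression operators, and the random seeds of all $\mathcal C_i^k$ and all the coin flips are mutually independent. Choose $$p=\min\Big\{1,\frac{\max\{1,\sqrt{n/(32\omega)}-1\}}{2(1+\omega)}\Big\},\quad \eta=\min\Big\{\frac1{2L},\frac{n}{64\omega(2p(\omega+1)+1)^2L}\Big\},\quad \theta_1=\min\Big\{\frac14,\sqrt{\frac{\eta\mu}{p}}\Big\},$$ $$\theta_2=\frac12,\quad \alpha=\frac1{\omega+1},\quad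 \gamma=\frac{\eta}{2(\theta_1+\eta\mu)},\quad \beta=1-\gamma\mu,$$ where quotients with denominator $0$ (the case $\omega=0$) are read as $+\infty$, so that $p=1$ and $\eta=\frac1{2L}$. Let $$\Psi^0=\|x^0-x^*\|^2+\Big(\frac{2\gamma\beta}{\theta_1}+\frac{2\gamma\beta\theta_2(1+\theta_1)}{\theta_1p}\Big)(P(x^0)-P(x^*))+\frac{8\gamma\eta\omega}{\alpha\theta_1n}\cdot\frac1n\sum_{i=1}^n\|h_i^0-\nabla f_i(x^0)\|^2 .$$ Then there is a universal constant $K>0$ (independent of the dimension, the problem, the compressors, the parameters, the initial data and $\epsilon$) such that for every $\epsilon>0$ one has $\mathbb E\|z^k-x^*\|^2\le\epsilon$ for every $$k\ \ge\ K\Big[\omega+\omega\sqrt{\tfrac{L}{n\mu}}\Big]\log\frac{\Psi^0}{\epsilon}\quad\text{if } n\le\omega,\qquad k\ \ge\ K\Big[\omega+\sqrt{\tfrac L\mu}+\sqrt{\sqrt{\tfrac\omega n}\,\tfrac{\omega L}{\mu}}\Big]\log\frac{\Psi^0}{\epsilon}\quad\text{if } n>\omega$$ (if $\Psi^0=0$,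 this holds for every $k\ge 0$). -/

import Mathlib

open MeasureTheory ProbabilityTheory

noncomputable section

/-- The space `ℝ^d` with its Euclidean norm. -/
abbrev Vec (d : ℕ) : Type := EuclideanSpace ℝ (Fin d)

/-- `g` is differentiable and its gradient is `L`-Lipschitz. -/
def IsLSmooth {d : ℕ} (L : ℝ) (g : Vec d → ℝ) : Prop :=
  Differentiable ℝ g ∧ ∀ x y, ‖gradient g x - gradient g y‖ ≤ L * ‖x - y‖

/-- A proper, convex (its epigraph is convex), closed (lower semicontinuous) function
with values in `ℝ ∪ {+∞}`. -/
structure IsProperClosedConvex {d : ℕ} (ψ : Vec d → EReal) : Prop where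
  ne_bot : ∀ x, ψ x ≠ ⊥
  exists_ne_top : ∃ x, ψ x ≠ ⊤
  convex : Convex ℝ {q : Vec d × ℝ | ψ q.1 ≤ (q.2 : EReal)}
  closed : LowerSemicontinuous ψ

/-- `f = (1/n) ∑ f_i`. -/
def avgLoss {d n : ℕ} (f : Fin n → Vec d → ℝ) (x : Vec d) : ℝ :=
  (1 / (n : ℝ)) * ∑ i, f i x

/-- The composite objective `P = (1/n) ∑ f_i + ψ`. -/
def objective {d n : ℕ} (f : Fin n → Vec d → ℝ) (ψ : Vec d → EReal) (x : Vec d) : EReal :=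
  (avgLoss f x : EReal) + ψ x

/-- `u` minimizes `u' ↦ ψ u' + ‖u' - v‖² / (2η)`. -/
def IsProx {d : ℕ} (η : ℝ) (ψ : Vec d → EReal) (v u : Vec d) : Prop :=
  ∀ u', ψ u + ((‖u - v‖ ^ 2 / (2 * η) : ℝ) : EReal)
    ≤ ψ u' + ((‖u' - v‖ ^ 2 / (2 * η) : ℝ) : EReal)

/-- The proximal operator `prox_{ηψ}`. -/
def prox {d : ℕ} (η : ℝ) (ψ : Vec d → EReal) (v : Vec d) : Vec d :=
  Classical.epsilon (IsProx η ψ v)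

/-- `c : S → ℝ^d → ℝ^d` is an `ω`-compression operator when its random seed has law `ν`. -/
structure IsCompressor {d : ℕ} {S : Type*} [MeasurableSpace S] (ω : ℝ) (ν : Measure S)
    (c : S → Vec d → Vec d) : Prop where
  measurable : Measurable (Function.uncurry c)
  integrable : ∀ x, Integrable (fun s => c s x) ν
  unbiased : ∀ x, ∫ s, c s x ∂ν = x
  integrable_sq : ∀ x, Integrable (fun s => ‖c s x - x‖ ^ 2) ν
  variance_le : ∀ x, ∫ s, ‖c s x - x‖ ^ 2 ∂ν ≤ ω * ‖x‖ ^ 2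

/-- The scalar parameters of ADIANA. -/
structure AdianaParams where
  η : ℝ
  θ₁ : ℝ
  θ₂ : ℝ
  α : ℝ
  β : ℝ
  γ : ℝ
  p : ℝ

/-- `p = min {1, max {1, √(n/(32ω)) - 1} / (2(1+ω))}`, where `n/(32ω) = +∞` if `ω = 0`. -/
def adianaP (n : ℕ) (ω : ℝ) : ℝ :=
  if ω = 0 then 1
  else min 1 (max 1 (√((n : ℝ) / (32 * ω)) - 1) / (2 * (1 + ω)))

/-- `η = min {1/(2L), n/(64ω(2p(ω+1)+1)²L)}`, where the second term is `+∞` if `ω = 0`. -/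
def adianaEta (n : ℕ) (ω L : ℝ) : ℝ :=
  if ω = 0 then 1 / (2 * L)
  else min (1 / (2 * L)) ((n : ℝ) / (64 * ω * (2 * adianaP n ω * (ω + 1) + 1) ^ 2 * L))

/-- `θ₁ = min {1/4, √(ημ/p)}`. -/
def adianaTheta₁ (n : ℕ) (ω L μ : ℝ) : ℝ :=
  min (1 / 4) (√(adianaEta n ω L * μ / adianaP n ω))

/-- `γ = η / (2(θ₁ + ημ))`. -/
def adianaGamma (n : ℕ) (ω L μ : ℝ) : ℝ :=
  adianaEta n ω L / (2 * (adianaTheta₁ n ω L μ + adianaEta n ω L * μ))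

/-- The choice of parameters in the convergence theorem. -/
def adianaParams (n : ℕ) (ω L μ : ℝ) : AdianaParams where
  η := adianaEta n ω L
  θ₁ := adianaTheta₁ n ω L μ
  θ₂ := 1 / 2
  α := 1 / (ω + 1)
  β := 1 - adianaGamma n ω L μ * μ
  γ := adianaGamma n ω L μ
  p := adianaP n ω

/-- The variables that ADIANA keeps between iterations: `z^k`, `y^k`, `w^k`, the local shifts
`h_i^k` and the server's shift `h^k`. -/
structure AdianaState (d n : ℕ) where
  z : Vec d
  y : Vec d
  w : Vec d
  hloc : Fin n → Vec d
  h : Vec d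

/-- Initialization: `z^0 = y^0 = w^0 = x^0`, `h^0 = (1/n) ∑ h_i^0`. -/
def adianaInit {d n : ℕ} (x₀ : Vec d) (h₀ : Fin n → Vec d) : AdianaState d n where
  z := x₀
  y := x₀
  w := x₀
  hloc := h₀
  h := (1 / (n : ℝ)) • ∑ i, h₀ i

/-- One iteration of ADIANA; `c i` is the realization of the compressor of machine `i`
(used for both of its messages) and `coin` tells whether `w` is refreshed. -/
def adianaStep {d n : ℕ} (q : AdianaParams) (f : Fin n → Vec d → ℝ) (ψ : Vec d → EReal)
    (c : Fin n → Vec d → Vec d) (coin : Bool) (s : AdianaState d n) : AdianaState d n :=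
  let x : Vec d := q.θ₁ • s.z + q.θ₂ • s.w + (1 - q.θ₁ - q.θ₂) • s.y
  let g : Vec d := (1 / (n : ℝ)) • (∑ i, c i (gradient (f i) x - s.hloc i)) + s.h
  let y' : Vec d := prox q.η ψ (x - q.η • g)
  { z := q.β • s.z + (1 - q.β) • x + (q.γ / q.η) • (y' - x)
    y := y'
    w := if coin then s.y else s.w
    hloc := fun i => s.hloc i + q.α • c i (gradient (f i) s.w - s.hloc i)
    h := s.h + q.α • ((1 / (n : ℝ)) • ∑ i, c i (gradient (f i) s.w - s.hloc i)) }

/-- The state of ADIANA after `k` iterations, for realizations `c k i` of the compressors and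
`coin k` of the coin flips. -/
def adianaIter {d n : ℕ} (q : AdianaParams) (f : Fin n → Vec d → ℝ) (ψ : Vec d → EReal)
    (x₀ : Vec d) (h₀ : Fin n → Vec d) (c : ℕ → Fin n → Vec d → Vec d) (coin : ℕ → Bool) :
    ℕ → AdianaState d n
  | 0 => adianaInit x₀ h₀
  | k + 1 => adianaStep q f ψ (c k) (coin k) (adianaIter q f ψ x₀ h₀ c coin k)

/-- The initial error `Ψ⁰` inside the logarithm: squared distance to `xs`, objective gap at the
two auxiliary sequences `y`, `w` (both start at `x₀`) and error of the initial shifts. -/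
def adianaInitError {d n : ℕ} (q : AdianaParams) (ω : ℝ) (f : Fin n → Vec d → ℝ)
    (ψ : Vec d → EReal) (x₀ : Vec d) (h₀ : Fin n → Vec d) (xs : Vec d) : ℝ :=
  let gap : ℝ := (objective f ψ x₀).toReal - (objective f ψ xs).toReal
  ‖x₀ - xs‖ ^ 2
    + 2 * q.γ * q.β / q.θ₁ * gap
    + 2 * q.γ * q.β * (q.θ₂ * (1 + q.θ₁) / (q.θ₁ * q.p)) * gap
    + 8 * q.γ * q.η * ω / (q.α * q.θ₁ * n)
        * ((1 / (n : ℝ)) * ∑ i, ‖h₀ i - gradient (f i) x₀‖ ^ 2)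

/-- The factor in front of the logarithm in the iteration bound. -/
def adianaRate (n : ℕ) (ω L μ : ℝ) : ℝ :=
  if (n : ℝ) ≤ ω then ω + ω * √(L / (n * μ))
  else ω + √(L / μ) + √(√(ω / n) * (ω * L / μ))

end

/-! ### Smooth and strongly convex functions. -/

section ConvexAnalysis

variable {E : Type*} [NormedAddCommGroup E] [InnerProductSpace ℝ E]

/-! The proof is a Lyapunov argument. The function `lyapunov` adds to `‖z - xs‖²` weighted objective
gaps at `y` and `w` and the mean squared error of the shifts `h_i` as estimates of `∇f_i(w)`. From
any fixed admissible state its expectation after one iteration is at most `1 - rate` times its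
value, where `rate` is the minimum of `γμ`, `θ₁/2`, `pθ₁/(1+θ₁)` and `α/4`, one contraction per
term.

The deterministic core is `norm_sub_sq_add_gap_le`. The variational inequality of the proximal step
is tested at `xs`, `w` and `y` with weights `1`, `βθ₂/θ₁` and `β(1-θ₁-θ₂)/θ₁`. Since `x` is a convex
combination of `z`, `w`, `y`, these weights turn the three tests into an estimate for `zp - xs`.
Strong convexity at `xs` pays for the part of `x` mixed into the new `z`. What remains is gradient
noise, linear and quadratic, together with the Bregman divergences of `f` from `x` to `w` and to
`y`, which enter with a negative sign.

In expectation the linear noise vanishes, because its other factor is determined by the state. The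
quadratic noise is at most `ω/n` times the mean of `‖∇f_i(x) - h_i‖²`, hence is controlled by the
shift error and the divergence at `w`. The shift error shrinks by `1 - α`, but the reference point
moves from `w` to `y` with probability `p`; the resulting gradient difference is controlled by the
two divergences. The bound on `η` makes these positive divergence terms no larger than the negative
ones (`bregman_w_le`, `bregman_y_le`), and `expected_bound_le` collects everything.

The randomness of iteration `k` is independent of the state before it, so the contraction iterates
to `(1 - rate)^k Ψ⁰`. Finally `one_le_mul_adianaRate_mul_rate` shows `1/rate ≤ 400 * adianaRate`: up
to constants `1/rate` is at most `(1+ω) + 1/√(pημ)`, and both summands are bounded by `adianaRate`.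
-/

theorem nonneg_of_forall_add_mul_nonneg {a b : ℝ}
    (h : ∀ t : ℝ, 0 < t → t < 1 → 0 ≤ a + t * b) : 0 ≤ a := by
  have hc : Filter.Tendsto (fun t : ℝ => a + t * b) (nhdsWithin 0 (Set.Ioi 0)) (nhds (a + 0 * b)) := by
    apply Filter.Tendsto.mono_left _ nhdsWithin_le_nhds
    exact (by fun_prop : Continuous fun t : ℝ => a + t * b).tendsto 0
  have := ge_of_tendsto hc (b := 0) (by
    filter_upwards [Ioo_mem_nhdsGT (zero_lt_one (α := ℝ))] with t ht
    exact h t ht.1 ht.2)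
  simpa using this

theorem hasDerivAt_comp_segment [CompleteSpace E] {f : E → ℝ} {g x v : E} {t : ℝ}
    (hf : HasGradientAt f g (x + t • v)) :
    HasDerivAt (fun s : ℝ => f (x + s • v)) (inner ℝ g v) t := by
  have h1 : HasDerivAt (fun s : ℝ => x + s • v) v t := by
    simpa using ((hasDerivAt_id t).smul_const v).const_add x
  have := hf.hasFDerivAt.comp_hasDerivAt t h1
  simpa [Function.comp_def] using this

/-- The descent lemma. -/
theorem le_add_inner_add_sq_of_lipschitz_gradient [CompleteSpace E] {f : E → ℝ} {f' : E → E} {L : ℝ}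
    (hf : ∀ x, HasGradientAt f (f' x) x) (hL : ∀ x y, ‖f' x - f' y‖ ≤ L * ‖x - y‖) (x y : E) :
    f y ≤ f x + inner ℝ (f' x) (y - x) + L / 2 * ‖y - x‖ ^ 2 := by
  set v := y - x with hv
  -- `φ` is `f` along the segment minus its quadratic upper model; the Lipschitz bound makes it
  -- decreasing on `[0, 1]`, and its endpoint values give the claim.
  set φ : ℝ → ℝ := fun t => f (x + t • v) - t * inner ℝ (f' x) v - L / 2 * t ^ 2 * ‖v‖ ^ 2
  have hφ : ∀ t, HasDerivAt φ
      (inner ℝ (f' (x + t • v)) v - inner ℝ (f' x) v - L * t * ‖v‖ ^ 2) t := by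
    intro t
    have h1 := hasDerivAt_comp_segment (v := v) (hf (x + t • v))
    have h2 : HasDerivAt (fun t : ℝ => t * inner ℝ (f' x) v) (inner ℝ (f' x) v) t := by
      simpa using (hasDerivAt_id t).mul_const (inner ℝ (f' x) v)
    have h3 : HasDerivAt (fun t : ℝ => L / 2 * t ^ 2 * ‖v‖ ^ 2) (L * t * ‖v‖ ^ 2) t := by
      refine (((hasDerivAt_pow 2 t).const_mul (L / 2)).mul_const (‖v‖ ^ 2)).congr_deriv ?_
      push_cast; ring
    exact (h1.sub h2).sub h3
  have hanti : AntitoneOn φ (Set.Icc 0 1) := by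
    apply antitoneOn_of_deriv_nonpos (convex_Icc 0 1)
    · exact fun t _ => (hφ t).continuousAt.continuousWithinAt
    · exact fun t _ => (hφ t).differentiableAt.differentiableWithinAt
    · intro t ht
      rw [interior_Icc] at ht
      rw [(hφ t).deriv, ← inner_sub_left]
      have h1 := real_inner_le_norm (f' (x + t • v) - f' x) v
      have h2 := hL (x + t • v) x
      rw [add_sub_cancel_left, norm_smul, Real.norm_of_nonneg ht.1.le] at h2
      nlinarith [norm_nonneg v, mul_le_mul_of_nonneg_right h2 (norm_nonneg v)]
  have := hanti (by simp : (0 : ℝ) ∈ Set.Icc (0 : ℝ) 1) (by simp : (1 : ℝ) ∈ Set.Icc (0 : ℝ) 1)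
    zero_le_one
  simp only [φ, hv] at this
  simp at this
  simp only [hv]
  linarith

/-- The first-order characterization of strong convexity. -/
theorem StrongConvexOn.add_inner_add_sq_le [CompleteSpace E] {f : E → ℝ} {m : ℝ} {g x : E}
    (hf : StrongConvexOn Set.univ m f) (hg : HasGradientAt f g x) (y : E) :
    f x + inner ℝ g (y - x) + m / 2 * ‖y - x‖ ^ 2 ≤ f y := by
  have hd : HasDerivAt (fun t : ℝ => f (x + t • (y - x))) (inner ℝ g (y - x)) 0 :=
    hasDerivAt_comp_segment (by simpa using hg)
  have hs := hd.tendsto_slope_zero_right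
  have hr : Filter.Tendsto (fun t : ℝ => f y - f x - (1 - t) * (m / 2 * ‖y - x‖ ^ 2))
      (nhdsWithin 0 (Set.Ioi 0)) (nhds (f y - f x - (1 - 0) * (m / 2 * ‖y - x‖ ^ 2))) := by
    apply Filter.Tendsto.mono_left _ nhdsWithin_le_nhds
    exact (by fun_prop :
      Continuous fun t : ℝ => f y - f x - (1 - t) * (m / 2 * ‖y - x‖ ^ 2)).tendsto 0
  have := le_of_tendsto_of_tendsto hs hr (by
    filter_upwards [Ioo_mem_nhdsGT (zero_lt_one (α := ℝ))] with t ht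
    have h1 := hf.2 (Set.mem_univ x) (Set.mem_univ y) 
      (sub_nonneg.2 ht.2.le) ht.1.le (by ring)
    have h2 : (1 - t) • x + t • y = x + t • (y - x) := by
      rw [sub_smul, one_smul, smul_sub]; abel
    rw [h2, norm_sub_rev] at h1
    simp only [zero_add, zero_smul, add_zero, smul_eq_mul] at h1 ⊢
    rw [inv_mul_le_iff₀ ht.1]
    linarith)
  linarith

theorem ConvexOn.add_inner_le [CompleteSpace E] {f : E → ℝ} {g x : E}
    (hf : ConvexOn ℝ Set.univ f) (hg : HasGradientAt f g x) (y : E) :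
    f x + inner ℝ g (y - x) ≤ f y := by
  have := StrongConvexOn.add_inner_add_sq_le (strongConvexOn_zero.2 hf) hg y
  simpa using this

/-- The Bregman divergence of a smooth convex function controls the squared difference of
gradients. -/
theorem norm_gradient_sub_sq_le [CompleteSpace E] {f : E → ℝ} {f' : E → E} {L : ℝ} (hL0 : 0 < L)
    (hc : ConvexOn ℝ Set.univ f)
    (hf : ∀ x, HasGradientAt f (f' x) x) (hL : ∀ x y, ‖f' x - f' y‖ ≤ L * ‖x - y‖) (x u : E) :
    ‖f' u - f' x‖ ^ 2 ≤ 2 * L * (f u - f x - inner ℝ (f' x) (u - x)) := by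
  -- The test point is a gradient step of length `1/L` from `u` for `f - ⟨f' x, ·⟩`, a convex
  -- function minimized at `x`. The value of `f` there is bounded above by smoothness at `u` and
  -- below by convexity at `x`.
  have h1 := le_add_inner_add_sq_of_lipschitz_gradient hf hL u (u - L⁻¹ • (f' u - f' x))
  have h2 := hc.add_inner_le (hf x) (u - L⁻¹ • (f' u - f' x))
  have e : inner ℝ (f' u) (f' u - f' x) - inner ℝ (f' x) (f' u - f' x) = ‖f' u - f' x‖ ^ 2 := by
    rw [← inner_sub_left, real_inner_self_eq_norm_sq]
  have e1 : u - L⁻¹ • (f' u - f' x) - u = -(L⁻¹ • (f' u - f' x)) := by abel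
  have e2 : u - L⁻¹ • (f' u - f' x) - x = (u - x) - (L⁻¹ • (f' u - f' x)) := by abel
  rw [e1, inner_neg_right, norm_neg, norm_smul, real_inner_smul_right, Real.norm_of_nonneg
    (inv_nonneg.2 hL0.le)] at h1
  rw [e2, inner_sub_right, real_inner_smul_right] at h2
  have h3 : L / 2 * (L⁻¹ * ‖f' u - f' x‖) ^ 2 = L⁻¹ / 2 * ‖f' u - f' x‖ ^ 2 := by
    field_simp
  rw [h3] at h1
  have h4 : L⁻¹ / 2 * ‖f' u - f' x‖ ^ 2 ≤ f u - f x - inner ℝ (f' x) (u - x) := by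
    rw [← e] at h1 ⊢
    linarith
  calc ‖f' u - f' x‖ ^ 2 = 2 * L * (L⁻¹ / 2 * ‖f' u - f' x‖ ^ 2) := by field_simp
    _ ≤ _ := by gcongr

end ConvexAnalysis

/-! ### The proximal operator. -/

section Prox

variable {d : ℕ}

namespace IsProperClosedConvex

variable {ψ : Vec d → EReal}

theorem coe_toReal (hψ : IsProperClosedConvex ψ) {x : Vec d} (hx : ψ x ≠ ⊤) :
    ((ψ x).toReal : EReal) = ψ x :=
  EReal.coe_toReal hx (hψ.ne_bot x)

theorem segment_le (hψ : IsProperClosedConvex ψ) {x y : Vec d} (hx : ψ x ≠ ⊤) (hy : ψ y ≠ ⊤)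
    {t : ℝ} (h0 : 0 ≤ t) (h1 : t ≤ 1) :
    ψ (x + t • (y - x)) ≤ (((1 - t) * (ψ x).toReal + t * (ψ y).toReal : ℝ) : EReal) := by
  have h := hψ.convex (x := (x, (ψ x).toReal)) (hψ.coe_toReal hx).ge (y := (y, (ψ y).toReal))
    (hψ.coe_toReal hy).ge (a := 1 - t) (b := t) (by linarith) h0 (by ring)
  have e : (1 - t) • x + t • y = x + t • (y - x) := by
    rw [sub_smul, one_smul, smul_sub]; abel
  simpa [e] using h

end IsProperClosedConvex

namespace IsProx

variable {ψ : Vec d → EReal} {η : ℝ} {u v : Vec d}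

theorem ne_top (hψ : IsProperClosedConvex ψ) (h : IsProx η ψ v u) : ψ u ≠ ⊤ := by
  intro hu
  obtain ⟨x, hx⟩ := hψ.exists_ne_top
  have := h x
  rw [hu, ← hψ.coe_toReal hx, ← EReal.coe_add, EReal.top_add_coe] at this
  exact EReal.coe_ne_top _ (top_le_iff.1 this)

/-- The variational inequality that characterizes the proximal point. -/
theorem add_inner_le (hψ : IsProperClosedConvex ψ) (hη : 0 < η) (h : IsProx η ψ v u) {x : Vec d}
    (hx : ψ x ≠ ⊤) :
    η * (ψ u).toReal + inner ℝ (v - u) (x - u) ≤ η * (ψ x).toReal := by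
  have hu := h.ne_top hψ
  suffices 0 ≤ η * (ψ x).toReal - η * (ψ u).toReal - inner ℝ (v - u) (x - u) by linarith
  -- The minimizer is compared with the point a fraction `t` of the way to `x`; after division by
  -- `t` the quadratic term is still of order `t` and disappears in the limit.
  refine nonneg_of_forall_add_mul_nonneg (b := ‖x - u‖ ^ 2 / 2) fun t h0 h1 => ?_
  have h2 := (h (u + t • (x - u))).trans (add_le_add (hψ.segment_le hu hx h0.le h1.le) le_rfl)
  rw [← hψ.coe_toReal hu, ← EReal.coe_add, ← EReal.coe_add, EReal.coe_le_coe_iff, EReal.toReal_coe] at h2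
  have e : u + t • (x - u) - v = t • (x - u) - (v - u) := by abel
  rw [e, norm_sub_sq_real (t • (x - u)), norm_sub_rev u v, norm_smul, real_inner_smul_left,
    Real.norm_of_nonneg h0.le, real_inner_comm] at h2
  have h3 := mul_le_mul_of_nonneg_left h2 (by positivity : 0 ≤ 2 * η)
  have h4 : 2 * η * ((EReal.toReal (ψ u)) + ‖v - u‖ ^ 2 / (2 * η))
      = 2 * η * (ψ u).toReal + ‖v - u‖ ^ 2 := by field_simp
  rw [h4, mul_add, mul_div_cancel₀ _ (by positivity)] at h3
  have h5 : 0 ≤ t * (2 * (η * (ψ x).toReal - η * (ψ u).toReal - inner ℝ (v - u) (x - u)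
      + t * (‖x - u‖ ^ 2 / 2))) := by nlinarith
  have := nonneg_of_mul_nonneg_right h5 h0
  linarith

/-- Each point is tested in the variational inequality of the other; the sum and Cauchy–Schwarz give
nonexpansiveness. It serves to make `prox` continuous, hence the iterates measurable. -/
theorem norm_sub_le (hψ : IsProperClosedConvex ψ) (hη : 0 < η) (h : IsProx η ψ v u)
    {v' u' : Vec d} (h' : IsProx η ψ v' u') : ‖u - u'‖ ≤ ‖v - v'‖ := by
  have h1 := h.add_inner_le hψ hη (h'.ne_top hψ)
  have h2 := h'.add_inner_le hψ hη (h.ne_top hψ)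
  have e1 : u' - u = -(u - u') := by abel
  rw [e1, inner_neg_right] at h1
  have e2 : inner ℝ (v' - u') (u - u') - inner ℝ (v - u) (u - u')
      = ‖u - u'‖ ^ 2 - inner ℝ (v - v') (u - u') := by
    rw [← real_inner_self_eq_norm_sq, ← inner_sub_left, ← inner_sub_left]
    congr 1; abel
  have h3 := real_inner_le_norm (v - v') (u - u')
  by_contra hlt
  push Not at hlt
  nlinarith [norm_nonneg (v - v'), norm_nonneg (u - u')]

end IsProx

/-- Proximal points exist when `ψ` is bounded below by a concave quadratic of curvature less
than `1 / η`. -/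
theorem exists_isProx {ψ : Vec d → EReal} (hψ : IsProperClosedConvex ψ) {η : ℝ} {v : Vec d}
    {a b c : ℝ} (hc : c < 1 / (2 * η))
    (hlb : ∀ u, ((a - b * ‖u - v‖ - c * ‖u - v‖ ^ 2 : ℝ) : EReal) ≤ ψ u) :
    ∃ u, IsProx η ψ v u := by
  obtain ⟨x, hx⟩ := hψ.exists_ne_top
  set F : Vec d → EReal := fun u => ψ u + ((‖u - v‖ ^ 2 / (2 * η) : ℝ) : EReal) with hF
  have hFlsc : LowerSemicontinuous F := by
    intro u
    refine LowerSemicontinuousAt.add' (hψ.closed u) ?_ ?_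
    · have : Continuous fun u : Vec d => ((‖u - v‖ ^ 2 / (2 * η) : ℝ) : EReal) := by
        apply continuous_coe_real_ereal.comp; fun_prop
      exact this.lowerSemicontinuous u
    · exact EReal.continuousAt_add (Or.inr (EReal.coe_ne_bot _)) (Or.inr (EReal.coe_ne_top _))
  set κ := 1 / (2 * η) - c with hκ
  have hκ0 : 0 < κ := by rw [hκ]; linarith
  obtain ⟨m, hm⟩ : ∃ m : ℝ, F x = (m : EReal) := by
    refine ⟨(ψ x).toReal + ‖x - v‖ ^ 2 / (2 * η), ?_⟩
    rw [EReal.coe_add, hψ.coe_toReal hx]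
  have hgrow : ∀ u, ((a - b * ‖u - v‖ + κ * ‖u - v‖ ^ 2 : ℝ) : EReal) ≤ F u := by
    intro u
    have := add_le_add (hlb u) (le_refl (((‖u - v‖ ^ 2 / (2 * η) : ℝ) : EReal)))
    rw [← EReal.coe_add] at this
    convert this using 2
    rw [hκ]; ring
  -- Beyond this radius the quadratic growth `κ‖u - v‖²` already exceeds the value at `x`, so a
  -- minimizer over the compact ball is global.
  set R : ℝ := max ‖x - v‖ ((|b| + |m - a|) / κ + 1) with hR
  obtain ⟨u, -, hu⟩ := LowerSemicontinuousOn.exists_isMinOn (s := Metric.closedBall v R) (f := F)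
    ⟨x, by simp [hR, dist_eq_norm]⟩ (isCompact_closedBall v R) (hFlsc.lowerSemicontinuousOn _)
  refine ⟨u, fun u' => ?_⟩
  by_cases hu' : u' ∈ Metric.closedBall v R
  · exact hu hu'
  · have h1 : F u ≤ F x := hu (by simp [hR, dist_eq_norm])
    refine h1.trans (le_trans ?_ (hgrow u'))
    rw [hm, EReal.coe_le_coe_iff]
    rw [Metric.mem_closedBall, dist_eq_norm, not_le] at hu'
    have h2 : (|b| + |m - a|) / κ + 1 < ‖u' - v‖ := lt_of_le_of_lt (le_max_right _ _) hu'
    have h3 : 0 ≤ (|b| + |m - a|) / κ := by positivity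
    have h4 : |b| + |m - a| ≤ κ * ‖u' - v‖ := by
      rw [mul_comm, ← div_le_iff₀ hκ0]; linarith
    nlinarith [le_abs_self b, le_abs_self (m - a), abs_nonneg (m - a), abs_nonneg b]

theorem isProx_prox {ψ : Vec d → EReal} {η : ℝ} {v : Vec d} (h : ∃ u, IsProx η ψ v u) :
    IsProx η ψ v (prox η ψ v) :=
  Classical.epsilon_spec h

theorem continuous_prox {ψ : Vec d → EReal} (hψ : IsProperClosedConvex ψ) {η : ℝ} (hη : 0 < η)
    (h : ∀ v, IsProx η ψ v (prox η ψ v)) : Continuous (prox η ψ) := by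
  have : LipschitzWith 1 (prox η ψ) := by
    refine LipschitzWith.of_dist_le_mul fun v v' => ?_
    simpa [dist_eq_norm] using (h v).norm_sub_le hψ hη (h v')
  exact this.continuous

end Prox

/-! ### Relations between the parameters and the weights of the Lyapunov function. -/

/-- The relations between the parameters of ADIANA that its analysis uses. -/
structure AdianaParams.Admissible (q : AdianaParams) (n : ℕ) (ω L μ : ℝ) : Prop where
  n_pos : 0 < n
  L_pos : 0 < L
  μ_pos : 0 < μ
  ω_nonneg : 0 ≤ ω
  η_pos : 0 < q.η
  θ₁_pos : 0 < q.θ₁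
  θ₁_le : q.θ₁ ≤ 1 / 4
  θ₂_eq : q.θ₂ = 1 / 2
  p_pos : 0 < q.p
  p_le : q.p ≤ 1
  α_mul : q.α * (ω + 1) = 1
  γ_mul : q.γ * (2 * (q.θ₁ + q.η * μ)) = q.η
  β_eq : q.β = 1 - q.γ * μ
  η_mul_L_le : q.η * L ≤ 1 / 2
  variance_le : 64 * ω * (2 * q.p * (ω + 1) + 1) ^ 2 * L * q.η ≤ n

namespace AdianaParams

/-- Coefficient of the objective gap at `w` in the Lyapunov function. -/
noncomputable def wCoeff (q : AdianaParams) : ℝ := 2 * q.γ * q.β * (q.θ₂ * (1 + q.θ₁) / (q.θ₁ * q.p))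

/-- Coefficient of the objective gap at `y` in the Lyapunov function. -/
noncomputable def yCoeff (q : AdianaParams) : ℝ := 2 * q.γ * q.β / q.θ₁

/-- Coefficient of the error of the shifts in the Lyapunov function. -/
noncomputable def hCoeff (q : AdianaParams) (n : ℕ) (ω : ℝ) : ℝ := 8 * q.γ * q.η * ω / (q.α * q.θ₁ * n)

/-- Weight of the inequality tested at `w`. -/
noncomputable def wWeight (q : AdianaParams) : ℝ := q.β / q.θ₁ * q.θ₂

/-- Weight of the inequality tested at `y`. -/
noncomputable def yWeight (q : AdianaParams) : ℝ := q.β / q.θ₁ * (1 - q.θ₁ - q.θ₂)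

/-- Sum of the weights of the inequalities tested at `xs`, `w` and `y`. -/
noncomputable def totalWeight (q : AdianaParams) : ℝ := 1 + q.wWeight + q.yWeight

/-- The contraction factor is `1 - rate`. -/
noncomputable def rate (q : AdianaParams) (μ : ℝ) : ℝ :=
  min (min (q.γ * μ) (q.θ₁ / 2)) (min (q.p * q.θ₁ / (1 + q.θ₁)) (q.α / 4))

namespace Admissible

variable {q : AdianaParams} {n : ℕ} {ω L μ : ℝ}

theorem α_pos (h : q.Admissible n ω L μ) : 0 < q.α := by
  have := h.α_mul
  have h1 : 0 < ω + 1 := by linarith [h.ω_nonneg]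
  by_contra hα
  push Not at hα
  nlinarith

theorem α_le_one (h : q.Admissible n ω L μ) : q.α ≤ 1 := by
  have := h.α_mul
  nlinarith [h.α_pos, h.ω_nonneg]

theorem α_inv (h : q.Admissible n ω L μ) : 1 / q.α = ω + 1 := by
  rw [div_eq_iff h.α_pos.ne', mul_comm, h.α_mul]

theorem γ_pos (h : q.Admissible n ω L μ) : 0 < q.γ := by
  have h0 := h.γ_mul
  have h1 : 0 < 2 * (q.θ₁ + q.η * μ) := by
    have := mul_pos h.η_pos h.μ_pos
    linarith [h.θ₁_pos]
  by_contra hα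
  push Not at hα
  nlinarith [h.η_pos]

theorem γ_mul_μ_le (h : q.Admissible n ω L μ) : q.γ * μ ≤ 1 / 2 := by
  have h0 := h.γ_mul
  have h1 := mul_pos h.η_pos h.μ_pos
  have h2 : q.γ * μ * (2 * (q.θ₁ + q.η * μ)) ≤ 1 / 2 * (2 * (q.θ₁ + q.η * μ)) := by
    have : q.γ * μ * (2 * (q.θ₁ + q.η * μ)) = q.η * μ := by linear_combination μ * h0
    rw [this]
    linarith [h.θ₁_pos]
  exact le_of_mul_le_mul_right h2 (by linarith [h.θ₁_pos])

theorem half_le_β (h : q.Admissible n ω L μ) : 1 / 2 ≤ q.β := by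
  rw [h.β_eq]; linarith [h.γ_mul_μ_le]

theorem β_le_one (h : q.Admissible n ω L μ) : q.β ≤ 1 := by
  rw [h.β_eq]; linarith [mul_pos h.γ_pos h.μ_pos]

theorem wWeight_nonneg (h : q.Admissible n ω L μ) : 0 ≤ q.wWeight := by
  have := h.half_le_β
  have := h.θ₁_pos
  rw [wWeight, h.θ₂_eq]; positivity

theorem yWeight_nonneg (h : q.Admissible n ω L μ) : 0 ≤ q.yWeight := by
  have := h.half_le_β
  have := h.θ₁_pos
  have h2 : 0 ≤ 1 - q.θ₁ - 1 / 2 := by linarith [h.θ₁_le]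
  rw [yWeight, h.θ₂_eq]; positivity

theorem totalWeight_eq (h : q.Admissible n ω L μ) :
    q.totalWeight = (q.θ₁ + q.β * (1 - q.θ₁)) / q.θ₁ := by
  have := h.θ₁_pos
  rw [totalWeight, wWeight, yWeight]; field_simp; ring

theorem totalWeight_le (h : q.Admissible n ω L μ) : q.totalWeight ≤ 1 / q.θ₁ := by
  rw [h.totalWeight_eq]
  gcongr
  · exact h.θ₁_pos.le
  · nlinarith [h.β_le_one, h.θ₁_le]

theorem le_totalWeight (h : q.Admissible n ω L μ) : q.β / q.θ₁ ≤ q.totalWeight := by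
  rw [h.totalWeight_eq]
  gcongr
  · exact h.θ₁_pos.le
  · nlinarith [h.β_le_one, h.θ₁_pos]

/-- This lets the `-‖yp - x‖²/4` of every tested inequality, summed with the weights, absorb the
square `(γ/η)²‖yp - x‖²` coming from the update of `z`. -/
theorem γ_div_η_le (h : q.Admissible n ω L μ) : q.γ / q.η ≤ q.totalWeight / 2 := by
  refine le_trans ?_ (div_le_div_of_nonneg_right h.le_totalWeight zero_le_two)
  have h0 := h.γ_mul
  have h1 := mul_pos h.η_pos h.μ_pos
  rw [div_div, div_le_div_iff₀ h.η_pos (mul_pos h.θ₁_pos two_pos)]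
  have : q.β * q.η = q.γ * (2 * (q.θ₁ + q.η * μ)) - q.γ * μ * q.η := by
    rw [h.β_eq]; linarith
  rw [this]
  nlinarith [mul_pos h.γ_pos h1]

theorem wCoeff_nonneg (h : q.Admissible n ω L μ) : 0 ≤ q.wCoeff := by
  have := h.half_le_β
  have := h.θ₁_pos
  have := h.p_pos
  have := h.γ_pos
  rw [wCoeff, h.θ₂_eq]; positivity

theorem yCoeff_nonneg (h : q.Admissible n ω L μ) : 0 ≤ q.yCoeff := by
  have := h.half_le_β
  have := h.θ₁_pos
  have := h.γ_pos
  rw [yCoeff]; positivity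

theorem hCoeff_nonneg (h : q.Admissible n ω L μ) : 0 ≤ q.hCoeff n ω := by
  have := h.ω_nonneg
  have := h.θ₁_pos
  have := h.γ_pos
  have := h.η_pos
  have := h.α_pos
  rw [hCoeff]; positivity

theorem rate_nonneg (h : q.Admissible n ω L μ) : 0 ≤ q.rate μ := by
  have := h.μ_pos
  have := h.p_pos
  have := h.θ₁_pos
  have := h.γ_pos
  have := h.α_pos
  rw [rate]; positivity

theorem rate_le_γ_mul_μ : q.rate μ ≤ q.γ * μ :=
  (min_le_left _ _).trans (min_le_left _ _)

theorem rate_le_θ₁ : q.rate μ ≤ q.θ₁ / 2 := (min_le_left _ _).trans (min_le_right _ _)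

theorem rate_le_p : q.rate μ ≤ q.p * q.θ₁ / (1 + q.θ₁) :=
  (min_le_right _ _).trans (min_le_left _ _)

theorem rate_le_α : q.rate μ ≤ q.α / 4 := (min_le_right _ _).trans (min_le_right _ _)

/-- The factor `1 + θ₁` in `wCoeff` balances two effects: it costs half of the `θ₁` gained at `y`,
and it is what leaves a strict contraction at `w`. -/
theorem y_contraction (h : q.Admissible n ω L μ) :
    2 * q.γ * q.yWeight + q.wCoeff * q.p ≤ (1 - q.rate μ) * q.yCoeff := by
  have h1 := h.θ₁_pos
  have h2 := h.p_pos
  have e : 2 * q.γ * q.yWeight + q.wCoeff * q.p = (1 - q.θ₁ / 2) * q.yCoeff := by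
    rw [yWeight, wCoeff, yCoeff, h.θ₂_eq]; field_simp; ring
  rw [e]
  exact mul_le_mul_of_nonneg_right (by linarith [rate_le_θ₁ (q := q) (μ := μ)]) h.yCoeff_nonneg

theorem w_contraction (h : q.Admissible n ω L μ) :
    2 * q.γ * q.wWeight + q.wCoeff * (1 - q.p) ≤ (1 - q.rate μ) * q.wCoeff := by
  have h1 := h.θ₁_pos
  have h2 := h.p_pos
  have e : 2 * q.γ * q.wWeight + q.wCoeff * (1 - q.p)
      = (1 - q.p * q.θ₁ / (1 + q.θ₁)) * q.wCoeff := by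
    rw [wWeight, wCoeff, h.θ₂_eq]; field_simp; ring
  rw [e]
  exact mul_le_mul_of_nonneg_right (by linarith [rate_le_p (q := q) (μ := μ)]) h.wCoeff_nonneg

/-- The shift error contracts by `(1 + α/2)(1 - α)`. `hCoeff` is chosen so that the part of the
gradient noise due to the shifts costs at most a further `α/4`, which leaves a net gain of at least
`α/4`. -/
theorem h_contraction (h : q.Admissible n ω L μ) :
    q.γ * q.totalWeight * q.η * (2 * ω / n)
      + q.hCoeff n ω * ((1 + q.α / (2 * q.p) * q.p) * (1 - q.α))
      ≤ (1 - q.rate μ) * q.hCoeff n ω := by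
  have h1 := h.θ₁_pos
  have h2 := h.p_pos
  have h3 := h.α_pos
  have h4 := h.ω_nonneg
  have h5 := h.γ_pos
  have h6 := h.η_pos
  have h7 : (0 : ℝ) < n := Nat.cast_pos.2 h.n_pos
  have e1 : q.α / (2 * q.p) * q.p = q.α / 2 := by field_simp
  have e2 : q.γ * q.totalWeight * q.η * (2 * ω / n) ≤ q.α / 4 * q.hCoeff n ω := by
    have : q.α / 4 * q.hCoeff n ω = q.γ * (1 / q.θ₁) * q.η * (2 * ω / n) := by
      rw [hCoeff]; field_simp; ring
    rw [this]
    have := h.totalWeight_le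
    gcongr
  rw [e1]
  have h8 := rate_le_α (q := q) (μ := μ)
  have h9 : q.α / 4 + (1 + q.α / 2) * (1 - q.α) ≤ 1 - q.rate μ := by nlinarith
  have := mul_le_mul_of_nonneg_right h9 h.hCoeff_nonneg
  linarith

/-- This is the price of moving the reference point from `w` to `y`, in units of a Bregman
divergence. The square `(2p(ω+1)+1)²` in the choice of `η` arises here: one factor from Young's
inequality, one from `p/α = p(ω+1)`. -/
theorem hCoeff_mul_le (h : q.Admissible n ω L μ) :
    q.hCoeff n ω * (q.p * (1 + 1 / (q.α / (2 * q.p)))) * (4 * L) ≤ 1 / 4 * (q.γ / q.θ₁) := by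
  have h1 := h.θ₁_pos
  have h2 := h.p_pos
  have h3 := h.α_pos
  have h4 := h.ω_nonneg
  have h5 := h.γ_pos
  have h6 := h.η_pos
  have h7 : (0 : ℝ) < n := Nat.cast_pos.2 h.n_pos
  have h8 := h.L_pos
  set u := 2 * q.p * (ω + 1) + 1 with hu
  have e1 : 1 + 1 / (q.α / (2 * q.p)) = u := by
    rw [one_div_div, hu, ← h.α_inv]; ring
  have e2 : q.hCoeff n ω = 8 * q.γ * q.η * ω * (ω + 1) / (q.θ₁ * n) := by
    rw [hCoeff, ← h.α_inv]; field_simp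
  have h9 : 0 ≤ u := by positivity
  have h10 : q.p * (ω + 1) ≤ u / 2 := by rw [hu]; linarith
  have h11 : 64 * ω * u ^ 2 * L * q.η / n ≤ 1 := by
    rw [div_le_one h7]; exact h.variance_le
  rw [e1, e2]
  calc 8 * q.γ * q.η * ω * (ω + 1) / (q.θ₁ * n) * (q.p * u) * (4 * L)
      = 32 * (q.γ / q.θ₁) * (ω * u * L * q.η / n) * (q.p * (ω + 1)) := by field_simp; ring
    _ ≤ 32 * (q.γ / q.θ₁) * (ω * u * L * q.η / n) * (u / 2) := by gcongr
    _ = 1 / 4 * (q.γ / q.θ₁) * (64 * ω * u ^ 2 * L * q.η / n) := by ring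
    _ ≤ 1 / 4 * (q.γ / q.θ₁) * 1 := by gcongr
    _ = _ := by ring

/-- The available divergence at `w` has weight at least `γ/(2θ₁)`, because `β ≥ 1/2`; gradient noise
and the move of the reference point use at most `γ/(4θ₁)` each. -/
theorem bregman_w_le (h : q.Admissible n ω L μ) :
    q.γ * q.totalWeight * q.η * (2 * ω / n) * (2 * L)
      + q.hCoeff n ω * (q.p * (1 + 1 / (q.α / (2 * q.p)))) * (4 * L) ≤ 2 * q.γ * q.wWeight := by
  have h1 := h.θ₁_pos
  have h2 := h.p_pos
  have h4 := h.ω_nonneg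
  have h5 := h.γ_pos
  have h6 := h.η_pos
  have h7 : (0 : ℝ) < n := Nat.cast_pos.2 h.n_pos
  have h8 := h.L_pos
  have h9 : q.γ * q.totalWeight * q.η * (2 * ω / n) * (2 * L) ≤ 1 / 4 * (q.γ / q.θ₁) := by
    have h10 : 16 * ω * L * q.η / n ≤ 1 := by
      rw [div_le_one h7]
      refine le_trans ?_ h.variance_le
      have : 1 ≤ (2 * q.p * (ω + 1) + 1) ^ 2 := by
        have : 1 ≤ 2 * q.p * (ω + 1) + 1 := by
          have : 0 ≤ 2 * q.p * (ω + 1) := by positivity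
          linarith
        nlinarith
      have h11 : 0 ≤ ω * L * q.η := by positivity
      nlinarith
    calc q.γ * q.totalWeight * q.η * (2 * ω / n) * (2 * L)
        ≤ q.γ * (1 / q.θ₁) * q.η * (2 * ω / n) * (2 * L) := by
          have := h.totalWeight_le
          gcongr
      _ = 1 / 4 * (q.γ / q.θ₁) * (16 * ω * L * q.η / n) := by ring
      _ ≤ 1 / 4 * (q.γ / q.θ₁) * 1 := by gcongr
      _ = _ := by ring
  have h10 : q.γ / q.θ₁ * (1 / 2) ≤ 2 * q.γ * q.wWeight := by
    have : 2 * q.γ * q.wWeight = q.γ / q.θ₁ * q.β := by rw [wWeight, h.θ₂_eq]; ring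
    rw [this]
    have := h.half_le_β
    gcongr
  linarith [h.hCoeff_mul_le]

/-- The bound `θ₁ ≤ 1/4` keeps the weight of `y` large enough: `2γ * yWeight ≥ γ/(4θ₁)`. -/
theorem bregman_y_le (h : q.Admissible n ω L μ) :
    q.hCoeff n ω * (q.p * (1 + 1 / (q.α / (2 * q.p)))) * (4 * L) ≤ 2 * q.γ * q.yWeight := by
  refine h.hCoeff_mul_le.trans ?_
  have h1 := h.θ₁_pos
  have h5 := h.γ_pos
  have : 2 * q.γ * q.yWeight = q.β * (2 * (1 - q.θ₁ - 1 / 2)) * (q.γ / q.θ₁) := by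
    rw [yWeight, h.θ₂_eq]; ring
  rw [this]
  have h2 := h.half_le_β
  have h3 := h.θ₁_le
  gcongr
  nlinarith

/-- The expected Lyapunov function after one step, in terms of its parts, is at most
`1 - rate` times the present one. -/
theorem expected_bound_le (h : q.Admissible n ω L μ) {Z gy gw S Dw Dy V R : ℝ} (hZ : 0 ≤ Z)
    (hgy : 0 ≤ gy) (hgw : 0 ≤ gw) (hS : 0 ≤ S) (hDw : 0 ≤ Dw) (hDy : 0 ≤ Dy)
    (hV : V ≤ 2 * ω / n * (2 * L * Dw + S)) (hR : R ≤ 4 * L * (Dw + Dy)) :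
    q.β * Z + 2 * q.γ * q.wWeight * (gw - Dw) + 2 * q.γ * q.yWeight * (gy - Dy)
      + q.γ * q.totalWeight * q.η * V + q.wCoeff * (q.p * gy + (1 - q.p) * gw)
      + q.hCoeff n ω * ((1 + q.α / (2 * q.p) * q.p) * ((1 - q.α) * S)
        + q.p * (1 + 1 / (q.α / (2 * q.p))) * R)
      ≤ (1 - q.rate μ) * (Z + q.yCoeff * gy + q.wCoeff * gw + q.hCoeff n ω * S) := by
  have h1 : q.β ≤ 1 - q.rate μ := by
    rw [h.β_eq]; linarith [rate_le_γ_mul_μ (q := q) (μ := μ)]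
  have hM : 0 ≤ q.totalWeight := by
    have := h.wWeight_nonneg
    have := h.yWeight_nonneg
    rw [totalWeight]; positivity
  have hV' := mul_le_mul_of_nonneg_left hV
    (mul_nonneg (mul_nonneg h.γ_pos.le hM) h.η_pos.le)
  have hκ : 0 ≤ q.hCoeff n ω * (q.p * (1 + 1 / (q.α / (2 * q.p)))) := by
    have := h.hCoeff_nonneg
    have := h.p_pos
    have := h.α_pos
    positivity
  have hR' := mul_le_mul_of_nonneg_left hR hκ
  have a1 := mul_le_mul_of_nonneg_right h1 hZ
  have a2 := mul_le_mul_of_nonneg_right h.y_contraction hgy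
  have a3 := mul_le_mul_of_nonneg_right h.w_contraction hgw
  have a4 := mul_le_mul_of_nonneg_right h.h_contraction hS
  have a5 := mul_le_mul_of_nonneg_right h.bregman_w_le hDw
  have a6 := mul_le_mul_of_nonneg_right h.bregman_y_le hDy
  linear_combination a1 + a2 + a3 + a4 + a5 + a6 + hV' + hR'

end Admissible

end AdianaParams

/-! ### The deterministic one-step inequality. -/

section OneStep

variable {E : Type*} [NormedAddCommGroup E] [InnerProductSpace ℝ E]

theorem norm_convexCombo_sq_le (a b : E) {t : ℝ} (h0 : 0 ≤ t) (h1 : t ≤ 1) :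
    ‖t • a + (1 - t) • b‖ ^ 2 ≤ t * ‖a‖ ^ 2 + (1 - t) * ‖b‖ ^ 2 := by
  have e : t * ‖a‖ ^ 2 + (1 - t) * ‖b‖ ^ 2 - ‖t • a + (1 - t) • b‖ ^ 2
      = t * (1 - t) * ‖a - b‖ ^ 2 := by
    rw [norm_add_sq_real, norm_sub_sq_real, norm_smul, norm_smul, real_inner_smul_left,
      real_inner_smul_right, mul_pow, mul_pow, Real.norm_eq_abs, Real.norm_eq_abs, sq_abs, sq_abs]
    ring
  have : 0 ≤ t * (1 - t) * ‖a - b‖ ^ 2 := by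
    have : 0 ≤ 1 - t := by linarith
    positivity
  linarith

/-- The proximal step tested at the point `u`. -/
theorem inner_sub_le_of_prox_step {η L : ℝ} (hη : 0 < η) (hL : η * L ≤ 1 / 2)
    {x u g G yp : E} {fx fyp ψyp ψu : ℝ}
    (hsmooth : fyp ≤ fx + inner ℝ G (yp - x) + L / 2 * ‖yp - x‖ ^ 2)
    (hprox : η * ψyp + inner ℝ (x - η • g - yp) (u - yp) ≤ η * ψu) :
    inner ℝ (yp - x) (x - u) ≤ η * (ψu + fx + inner ℝ G (u - x) - (fyp + ψyp)
      + inner ℝ (g - G) (u - x)) + η ^ 2 / 2 * ‖g - G‖ ^ 2 - 1 / 4 * ‖yp - x‖ ^ 2 := by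
  set Δ := yp - x with hΔ
  have e1 : inner ℝ (x - η • g - yp) (u - yp)
      = inner ℝ Δ (x - u) + ‖Δ‖ ^ 2 - η * inner ℝ (g - G) (u - x) - η * inner ℝ G (u - x)
        + η * inner ℝ (g - G) Δ + η * inner ℝ G Δ := by
    have a1 : x - η • g - yp = -(Δ + η • g) := by rw [hΔ]; abel
    have a2 : u - yp = (u - x) - Δ := by rw [hΔ]; abel
    have a3 : x - u = -(u - x) := by abel
    rw [a1, a2, a3, ← real_inner_self_eq_norm_sq]
    simp only [inner_sub_right, inner_neg_left, inner_neg_right, inner_add_left, inner_sub_left,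
      real_inner_smul_left]
    ring
  -- Young's inequality for the noise against `Δ`. Of the `‖Δ‖²` given by the proximal step, one
  -- half goes here and `ηL/2 ≤ 1/4` to smoothness, so `1/4` is left.
  have h1 : 0 ≤ ‖η • (g - G) + Δ‖ ^ 2 := sq_nonneg _
  rw [norm_add_sq_real, norm_smul, real_inner_smul_left, Real.norm_of_nonneg hη.le, mul_pow] at h1
  have h2 := mul_le_mul_of_nonneg_left hsmooth hη.le
  have h3 := mul_le_mul_of_nonneg_right hL (sq_nonneg ‖Δ‖)
  rw [e1] at hprox
  nlinarith

/-- One step of ADIANA, for an arbitrary gradient estimate `g` of `G = ∇f(x)`. -/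
theorem AdianaParams.Admissible.norm_sub_sq_add_gap_le {q : AdianaParams} {n : ℕ} {ω L μ : ℝ}
    (h : q.Admissible n ω L μ) {x y w z xs yp zp g G : E} {fx fyp fs fw fy ψyp ψs ψw ψy : ℝ}
    (hx : x = q.θ₁ • z + q.θ₂ • w + (1 - q.θ₁ - q.θ₂) • y)
    (hzp : zp = q.β • z + (1 - q.β) • x + (q.γ / q.η) • (yp - x))
    (hsmooth : fyp ≤ fx + inner ℝ G (yp - x) + L / 2 * ‖yp - x‖ ^ 2)
    (hstrong : fx + inner ℝ G (xs - x) + μ / 2 * ‖xs - x‖ ^ 2 ≤ fs)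
    (hps : q.η * ψyp + inner ℝ (x - q.η • g - yp) (xs - yp) ≤ q.η * ψs)
    (hpw : q.η * ψyp + inner ℝ (x - q.η • g - yp) (w - yp) ≤ q.η * ψw)
    (hpy : q.η * ψyp + inner ℝ (x - q.η • g - yp) (y - yp) ≤ q.η * ψy) :
    ‖zp - xs‖ ^ 2 + 2 * q.γ * q.totalWeight * ((fyp + ψyp) - (fs + ψs))
      ≤ q.β * ‖z - xs‖ ^ 2
        + 2 * q.γ * q.wWeight * (((fw + ψw) - (fs + ψs)) - (fw - fx - inner ℝ G (w - x)))
        + 2 * q.γ * q.yWeight * (((fy + ψy) - (fs + ψs)) - (fy - fx - inner ℝ G (y - x)))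
        + 2 * q.γ * inner ℝ (g - G) ((xs - x) + q.wWeight • (w - x) + q.yWeight • (y - x))
        + q.γ * q.totalWeight * q.η * ‖g - G‖ ^ 2 := by
  have hη := h.η_pos
  have hθ := h.θ₁_pos
  have hγ := h.γ_pos
  set r := q.γ / q.η with hr
  have hr0 : 0 < r := div_pos hγ hη
  have hrη : r * q.η = q.γ := div_mul_cancel₀ _ hη.ne'
  set Δ := yp - x with hΔ
  have A1 := inner_sub_le_of_prox_step hη h.η_mul_L_le hsmooth hps
  have A2 := inner_sub_le_of_prox_step hη h.η_mul_L_le hsmooth hpw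
  have A3 := inner_sub_le_of_prox_step hη h.η_mul_L_le hsmooth hpy
  rw [← hΔ] at A1 A2 A3
  set a := q.wWeight
  set b := q.yWeight
  have ha : 0 ≤ a := h.wWeight_nonneg
  have hb : 0 ≤ b := h.yWeight_nonneg
  have A2' := mul_le_mul_of_nonneg_left A2 ha
  have A3' := mul_le_mul_of_nonneg_left A3 hb
  have hM : q.totalWeight = 1 + a + b := rfl
  have hrM : r ≤ (1 + a + b) / 2 := hM ▸ h.γ_div_η_le
  -- The weights at `w` and `y` are dictated by this identity: it writes `z - x` through the
  -- displacements at which the proximal step can be tested.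
  have e1 : q.β • (z - x) = a • (x - w) + b • (x - y) := by
    have h1 : z - x = (1 / q.θ₁) • (q.θ₂ • (x - w) + (1 - q.θ₁ - q.θ₂) • (x - y)) := by
      have h2 : q.θ₁ • (z - x) = q.θ₂ • (x - w) + (1 - q.θ₁ - q.θ₂) • (x - y) := by
        have : q.θ₁ • z = x - q.θ₂ • w - (1 - q.θ₁ - q.θ₂) • y := by rw [hx]; abel
        rw [smul_sub, this]
        module
      rw [← h2, smul_smul, one_div, inv_mul_cancel₀ hθ.ne', one_smul]
    rw [h1]
    simp only [a, b, AdianaParams.wWeight, AdianaParams.yWeight]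
    module
  have e2 : zp - xs = (q.β • (z - xs) + (1 - q.β) • (x - xs)) + r • Δ := by rw [hzp]; module
  have e3 : q.β • (z - xs) + (1 - q.β) • (x - xs)
      = (x - xs) + (a • (x - w) + b • (x - y)) := by rw [← e1]; module
  have B1 := norm_convexCombo_sq_le (z - xs) (x - xs) (t := q.β) (by linarith [h.half_le_β])
    h.β_le_one
  have e4 : ‖zp - xs‖ ^ 2 = ‖q.β • (z - xs) + (1 - q.β) • (x - xs)‖ ^ 2
      + 2 * r * (inner ℝ Δ (x - xs) + a * inner ℝ Δ (x - w) + b * inner ℝ Δ (x - y))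
      + r ^ 2 * ‖Δ‖ ^ 2 := by
    rw [e2, norm_add_sq_real, norm_smul, mul_pow, real_inner_smul_right, Real.norm_of_nonneg hr0.le]
    nth_rw 2 [e3]
    rw [real_inner_comm]
    simp only [inner_add_right, real_inner_smul_right]
    ring
  have e5 : inner ℝ (g - G) ((xs - x) + a • (w - x) + b • (y - x))
      = inner ℝ (g - G) (xs - x) + a * inner ℝ (g - G) (w - x) + b * inner ℝ (g - G) (y - x) := by
    simp only [inner_add_right, real_inner_smul_right]
  have C := mul_le_mul_of_nonneg_left (add_le_add A1 (add_le_add A2' A3'))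
    (by positivity : 0 ≤ 2 * r)
  have D : r * (r * ‖Δ‖ ^ 2) ≤ r * ((1 + a + b) / 2 * ‖Δ‖ ^ 2) := by gcongr
  -- The term `(1 - β)‖x - xs‖²` from convexity of the squared norm is exactly cancelled by strong
  -- convexity, by the choice of `β`.
  have hβ : 1 - q.β = q.γ * μ := by rw [h.β_eq]; ring
  rw [hβ] at B1 e4
  have F := mul_le_mul_of_nonneg_left hstrong (by positivity : 0 ≤ 2 * q.γ)
  rw [norm_sub_rev xs x] at F
  rw [e4, e5, hM, ← hrη]
  rw [← hrη] at B1 F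
  linear_combination B1 + C + D + F

end OneStep

/-! ### The composite problem and the pathwise bound on the Lyapunov function. -/

section Problem

variable {d n : ℕ}

/-- The gradient of `f = (1/n) ∑ f_i`. -/
noncomputable def avgGradient (f : Fin n → Vec d → ℝ) (x : Vec d) : Vec d :=
  (1 / (n : ℝ)) • ∑ i, gradient (f i) x

/-- The gap between the objective values at `u` and at `xs`. -/
noncomputable def objGap (f : Fin n → Vec d → ℝ) (ψ : Vec d → EReal) (xs u : Vec d) : ℝ :=
  (objective f ψ u).toReal - (objective f ψ xs).toReal

/-- The Bregman divergence of `f = (1/n) ∑ f_i`. -/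
noncomputable def avgBregman (f : Fin n → Vec d → ℝ) (u x : Vec d) : ℝ :=
  avgLoss f u - avgLoss f x - inner ℝ (avgGradient f x) (u - x)

/-- The composite problem `min f + ψ` with minimizer `xs`. -/
structure IsCompositeProblem (f : Fin n → Vec d → ℝ) (ψ : Vec d → EReal) (L μ : ℝ)
    (xs : Vec d) : Prop where
  n_pos : 0 < n
  convex : ∀ i, ConvexOn ℝ Set.univ (f i)
  smooth : ∀ i, IsLSmooth L (f i)
  strong : StrongConvexOn Set.univ μ (avgLoss f)
  proper : IsProperClosedConvex ψ
  isMin : ∀ x, objective f ψ xs ≤ objective f ψ x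

namespace IsCompositeProblem

variable {f : Fin n → Vec d → ℝ} {ψ : Vec d → EReal} {L μ : ℝ} {xs : Vec d}

theorem hasGradientAt (P : IsCompositeProblem f ψ L μ xs) (i : Fin n) (x : Vec d) :
    HasGradientAt (f i) (gradient (f i) x) x :=
  ((P.smooth i).1 x).hasGradientAt

theorem hasGradientAt_avgLoss (P : IsCompositeProblem f ψ L μ xs) (x : Vec d) :
    HasGradientAt (avgLoss f) (avgGradient f x) x := by
  have h : HasFDerivAt (avgLoss f)
      ((1 / (n : ℝ)) • ∑ i, InnerProductSpace.toDual ℝ (Vec d) (gradient (f i) x)) x :=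
    (HasFDerivAt.fun_sum fun i _ => (P.hasGradientAt i x).hasFDerivAt).const_mul _
  have e : InnerProductSpace.toDual ℝ (Vec d) ((1 / (n : ℝ)) • ∑ i, gradient (f i) x)
      = (1 / (n : ℝ)) • ∑ i, InnerProductSpace.toDual ℝ (Vec d) (gradient (f i) x) := by
    simp
  rw [hasGradientAt_iff_hasFDerivAt, avgGradient, e]
  exact h

theorem continuous_gradient (P : IsCompositeProblem f ψ L μ xs) (i : Fin n) :
    Continuous (gradient (f i)) := by
  have : LipschitzWith L.toNNReal (gradient (f i)) :=
    LipschitzWith.of_dist_le_mul fun x y => by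
      rw [dist_eq_norm, dist_eq_norm]
      exact ((P.smooth i).2 x y).trans
        (mul_le_mul_of_nonneg_right (Real.le_coe_toNNReal L) (norm_nonneg _))
  exact this.continuous

theorem norm_avgGradient_sub_le (P : IsCompositeProblem f ψ L μ xs) (x y : Vec d) :
    ‖avgGradient f x - avgGradient f y‖ ≤ L * ‖x - y‖ := by
  have hn : (0 : ℝ) < n := Nat.cast_pos.2 P.n_pos
  rw [avgGradient, avgGradient, ← smul_sub, ← Finset.sum_sub_distrib, norm_smul,
    Real.norm_of_nonneg (by positivity), one_div, inv_mul_le_iff₀ hn]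
  calc ‖∑ i, (gradient (f i) x - gradient (f i) y)‖
      ≤ ∑ i, ‖gradient (f i) x - gradient (f i) y‖ := norm_sum_le _ _
    _ ≤ ∑ _i : Fin n, L * ‖x - y‖ := Finset.sum_le_sum fun i _ => (P.smooth i).2 x y
    _ = n * (L * ‖x - y‖) := by simp

theorem avgLoss_le (P : IsCompositeProblem f ψ L μ xs) (x y : Vec d) :
    avgLoss f y ≤ avgLoss f x + inner ℝ (avgGradient f x) (y - x) + L / 2 * ‖y - x‖ ^ 2 :=
  le_add_inner_add_sq_of_lipschitz_gradient P.hasGradientAt_avgLoss P.norm_avgGradient_sub_le x y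

theorem le_avgLoss (P : IsCompositeProblem f ψ L μ xs) (x y : Vec d) :
    avgLoss f x + inner ℝ (avgGradient f x) (y - x) + μ / 2 * ‖y - x‖ ^ 2 ≤ avgLoss f y :=
  P.strong.add_inner_add_sq_le (P.hasGradientAt_avgLoss x) y

/-- Upper and lower quadratic models are compared at a nonzero vector, which is why the dimension
must be positive. -/
theorem μ_le_L (P : IsCompositeProblem f ψ L μ xs) (hd : 0 < d) : μ ≤ L := by
  have : Nonempty (Fin d) := ⟨⟨0, hd⟩⟩
  obtain ⟨v, hv⟩ := exists_ne (0 : Vec d)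
  have h1 := P.avgLoss_le 0 v
  have h2 := P.le_avgLoss 0 v
  rw [sub_zero] at h1 h2
  have h3 : 0 < ‖v‖ ^ 2 := by positivity
  nlinarith

theorem sum_norm_gradient_sub_sq_le (P : IsCompositeProblem f ψ L μ xs) (hL : 0 < L)
    (u x : Vec d) :
    (1 / (n : ℝ)) * ∑ i, ‖gradient (f i) u - gradient (f i) x‖ ^ 2
      ≤ 2 * L * avgBregman f u x := by
  have h : ∀ i, ‖gradient (f i) u - gradient (f i) x‖ ^ 2
      ≤ 2 * L * (f i u - f i x - inner ℝ (gradient (f i) x) (u - x)) := fun i =>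
    norm_gradient_sub_sq_le hL (P.convex i) (P.hasGradientAt i) (P.smooth i).2 x u
  calc (1 / (n : ℝ)) * ∑ i, ‖gradient (f i) u - gradient (f i) x‖ ^ 2
      ≤ (1 / (n : ℝ)) * ∑ i, 2 * L * (f i u - f i x - inner ℝ (gradient (f i) x) (u - x)) := by
        gcongr with i; exact h i
    _ = 2 * L * avgBregman f u x := by
        rw [← Finset.mul_sum, Finset.sum_sub_distrib, Finset.sum_sub_distrib, ← sum_inner,
          avgBregman, avgGradient, real_inner_smul_left, avgLoss, avgLoss]
        ring

theorem avgBregman_nonneg (P : IsCompositeProblem f ψ L μ xs) (hμ : 0 ≤ μ) (u x : Vec d) :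
    0 ≤ avgBregman f u x := by
  have := P.le_avgLoss x u
  have : 0 ≤ μ / 2 * ‖u - x‖ ^ 2 := by positivity
  rw [avgBregman]; linarith

theorem ψ_xs_ne_top (P : IsCompositeProblem f ψ L μ xs) : ψ xs ≠ ⊤ := by
  intro h
  obtain ⟨x, hx⟩ := P.proper.exists_ne_top
  have := P.isMin x
  rw [objective, objective, h, EReal.coe_add_top, ← P.proper.coe_toReal hx, ← EReal.coe_add] at this
  exact EReal.coe_ne_top _ (top_le_iff.1 this)

theorem coe_objective (P : IsCompositeProblem f ψ L μ xs) {u : Vec d} (hu : ψ u ≠ ⊤) :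
    objective f ψ u = ((avgLoss f u + (ψ u).toReal : ℝ) : EReal) := by
  rw [objective, EReal.coe_add, P.proper.coe_toReal hu]

theorem objGap_eq (P : IsCompositeProblem f ψ L μ xs) {u : Vec d} (hu : ψ u ≠ ⊤) :
    objGap f ψ xs u
      = (avgLoss f u + (ψ u).toReal) - (avgLoss f xs + (ψ xs).toReal) := by
  rw [objGap, P.coe_objective hu, P.coe_objective P.ψ_xs_ne_top, EReal.toReal_coe,
    EReal.toReal_coe]

theorem objGap_nonneg (P : IsCompositeProblem f ψ L μ xs) {u : Vec d} (hu : ψ u ≠ ⊤) :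
    0 ≤ objGap f ψ xs u := by
  have := P.isMin u
  rw [P.coe_objective hu, P.coe_objective P.ψ_xs_ne_top, EReal.coe_le_coe_iff] at this
  rw [P.objGap_eq hu]
  linarith

/-- A lower bound for `ψ` comes from the minimizer: `ψ u ≥ P(xs) - f u`, and the descent lemma
bounds `f u` above by a quadratic of curvature `L`, less than `1/η`. -/
theorem isProx_prox (P : IsCompositeProblem f ψ L μ xs) {η : ℝ} (hη : 0 < η)
    (hL : η * L ≤ 1 / 2) (v : Vec d) : IsProx η ψ v (prox η ψ v) := by
  refine _root_.isProx_prox (exists_isProx P.proper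
    (a := avgLoss f xs + (ψ xs).toReal - avgLoss f v) (b := ‖avgGradient f v‖) (c := L / 2)
    ?_ fun u => ?_)
  · rw [div_lt_div_iff₀ two_pos (by positivity)]
    nlinarith
  · by_cases hu : ψ u = ⊤
    · rw [hu]; exact le_top
    · rw [← P.proper.coe_toReal hu, EReal.coe_le_coe_iff]
      have h1 := P.objGap_nonneg hu
      rw [P.objGap_eq hu] at h1
      have h2 := P.avgLoss_le v u
      have h3 := real_inner_le_norm (avgGradient f v) (u - v)
      linarith

end IsCompositeProblem

/-- The Lyapunov function of ADIANA. -/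
noncomputable def lyapunov (q : AdianaParams) (ω : ℝ) (f : Fin n → Vec d → ℝ) (ψ : Vec d → EReal)
    (xs : Vec d) (s : AdianaState d n) : ℝ :=
  ‖s.z - xs‖ ^ 2 + q.yCoeff * objGap f ψ xs s.y + q.wCoeff * objGap f ψ xs s.w
    + q.hCoeff n ω * ((1 / (n : ℝ)) * ∑ i, ‖s.hloc i - gradient (f i) s.w‖ ^ 2)

theorem lyapunov_init (q : AdianaParams) (ω : ℝ) (f : Fin n → Vec d → ℝ) (ψ : Vec d → EReal)
    (xs x₀ : Vec d) (h₀ : Fin n → Vec d) :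
    lyapunov q ω f ψ xs (adianaInit x₀ h₀) = adianaInitError q ω f ψ x₀ h₀ xs :=
  rfl

/-- The invariants of the states of ADIANA. -/
structure AdianaState.Valid (ψ : Vec d → EReal) (s : AdianaState d n) : Prop where
  y_ne_top : ψ s.y ≠ ⊤
  w_ne_top : ψ s.w ≠ ⊤
  h_eq : s.h = (1 / (n : ℝ)) • ∑ i, s.hloc i

/-- The point at which ADIANA evaluates the gradients. -/
noncomputable def AdianaState.query (q : AdianaParams) (s : AdianaState d n) : Vec d :=
  q.θ₁ • s.z + q.θ₂ • s.w + (1 - q.θ₁ - q.θ₂) • s.y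

namespace AdianaState.Valid

variable {f : Fin n → Vec d → ℝ} {ψ : Vec d → EReal} {L μ ω : ℝ} {xs : Vec d}
  {q : AdianaParams} {s : AdianaState d n}

theorem init {x₀ : Vec d} (hx : ψ x₀ ≠ ⊤) (h₀ : Fin n → Vec d) :
    (adianaInit x₀ h₀ : AdianaState d n).Valid ψ :=
  ⟨hx, hx, rfl⟩

theorem step (hs : s.Valid ψ) (hψ : IsProperClosedConvex ψ)
    (hprox : ∀ v, IsProx q.η ψ v (prox q.η ψ v)) (c : Fin n → Vec d → Vec d) (b : Bool) :
    (adianaStep q f ψ c b s).Valid ψ where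
  y_ne_top := (hprox _).ne_top hψ
  w_ne_top := by
    cases b
    · exact hs.w_ne_top
    · exact hs.y_ne_top
  h_eq := by
    simp only [adianaStep]
    rw [hs.h_eq, Finset.sum_add_distrib, smul_add, ← Finset.smul_sum, smul_comm q.α]

theorem lyapunov_ge (hs : s.Valid ψ) (P : IsCompositeProblem f ψ L μ xs)
    (hq : q.Admissible n ω L μ) : ‖s.z - xs‖ ^ 2 ≤ lyapunov q ω f ψ xs s := by
  have h1 := mul_nonneg hq.yCoeff_nonneg (P.objGap_nonneg hs.y_ne_top)
  have h2 := mul_nonneg hq.wCoeff_nonneg (P.objGap_nonneg hs.w_ne_top)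
  have h3 : 0 ≤ (1 / (n : ℝ)) * ∑ i, ‖s.hloc i - gradient (f i) s.w‖ ^ 2 := by positivity
  have h4 := mul_nonneg hq.hCoeff_nonneg h3
  rw [lyapunov]; linarith

/-- A bound on the Lyapunov function after one step with realizations `c` of the compressors and
`b` of the coin, whose dependence on `c` and `b` is explicit. -/
theorem lyapunov_step_le (hs : s.Valid ψ) (P : IsCompositeProblem f ψ L μ xs)
    (hq : q.Admissible n ω L μ) (c : Fin n → Vec d → Vec d) (b : Bool) :
    lyapunov q ω f ψ xs (adianaStep q f ψ c b s)
      ≤ (q.β * ‖s.z - xs‖ ^ 2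
          + 2 * q.γ * q.wWeight * (objGap f ψ xs s.w - avgBregman f s.w (s.query q))
          + 2 * q.γ * q.yWeight * (objGap f ψ xs s.y - avgBregman f s.y (s.query q)))
        + 2 * q.γ * inner ℝ ((1 / (n : ℝ)) • ∑ i,
              (c i (gradient (f i) (s.query q) - s.hloc i)
                - (gradient (f i) (s.query q) - s.hloc i)))
            ((xs - s.query q) + q.wWeight • (s.w - s.query q) + q.yWeight • (s.y - s.query q))
        + q.γ * q.totalWeight * q.η * ‖(1 / (n : ℝ)) • ∑ i,
              (c i (gradient (f i) (s.query q) - s.hloc i)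
                - (gradient (f i) (s.query q) - s.hloc i))‖ ^ 2
        + q.wCoeff * ((bif b then 1 else 0) * objGap f ψ xs s.y
            + (1 - bif b then 1 else 0) * objGap f ψ xs s.w)
        + q.hCoeff n ω *
          ((1 + q.α / (2 * q.p) * (bif b then 1 else 0)) * ((1 / (n : ℝ)) *
            ∑ i, ‖q.α • c i (gradient (f i) s.w - s.hloc i)
                - (gradient (f i) s.w - s.hloc i)‖ ^ 2)
          + (bif b then 1 else 0) * (1 + 1 / (q.α / (2 * q.p))) * ((1 / (n : ℝ)) *
            ∑ i, ‖gradient (f i) s.w - gradient (f i) s.y‖ ^ 2)) := by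
  have hprox := P.isProx_prox hq.η_pos hq.η_mul_L_le
  have hn : (0 : ℝ) < n := Nat.cast_pos.2 hq.n_pos
  set x := s.query q with hx
  set g : Vec d := (1 / (n : ℝ)) • (∑ i, c i (gradient (f i) x - s.hloc i)) + s.h with hg
  set yp := prox q.η ψ (x - q.η • g) with hyp
  have hgG : g - avgGradient f x = (1 / (n : ℝ)) • ∑ i,
      (c i (gradient (f i) x - s.hloc i) - (gradient (f i) x - s.hloc i)) := by
    rw [hg, hs.h_eq, avgGradient, Finset.sum_sub_distrib, Finset.sum_sub_distrib]
    module
  have hyp' : ψ yp ≠ ⊤ := (hprox _).ne_top P.proper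
  have hvar : ∀ {u : Vec d}, ψ u ≠ ⊤ →
      q.η * (ψ yp).toReal + inner ℝ (x - q.η • g - yp) (u - yp) ≤ q.η * (ψ u).toReal :=
    fun hu => (hprox _).add_inner_le P.proper hq.η_pos hu
  have main := hq.norm_sub_sq_add_gap_le (x := x) (z := s.z) (w := s.w) (y := s.y)
    (zp := q.β • s.z + (1 - q.β) • x + (q.γ / q.η) • (yp - x)) rfl rfl
    (P.avgLoss_le x yp) (P.le_avgLoss x xs) (hvar P.ψ_xs_ne_top) (hvar hs.w_ne_top)
    (hvar hs.y_ne_top) (fw := avgLoss f s.w) (fy := avgLoss f s.y)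
  rw [← P.objGap_eq hyp', ← P.objGap_eq hs.w_ne_top, ← P.objGap_eq hs.y_ne_top, hgG] at main
  -- The new gap at `y` enters `main` with a weight at least `yCoeff`, so it can be lowered to the
  -- Lyapunov coefficient.
  have hgap : q.yCoeff * objGap f ψ xs yp ≤ 2 * q.γ * q.totalWeight * objGap f ψ xs yp := by
    refine mul_le_mul_of_nonneg_right ?_ (P.objGap_nonneg hyp')
    have : q.yCoeff = 2 * q.γ * (q.β / q.θ₁) := by rw [AdianaParams.yCoeff]; ring
    rw [this]
    exact mul_le_mul_of_nonneg_left hq.le_totalWeight (by linarith [hq.γ_pos])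
  have hw : objGap f ψ xs (adianaStep q f ψ c b s).w
      = (bif b then 1 else 0) * objGap f ψ xs s.y
            + (1 - bif b then 1 else 0) * objGap f ψ xs s.w := by
    cases b <;> simp [adianaStep]
  have hα := hq.α_pos
  have hp := hq.p_pos
  have hh : (1 / (n : ℝ)) * ∑ i, ‖(adianaStep q f ψ c b s).hloc i
        - gradient (f i) (adianaStep q f ψ c b s).w‖ ^ 2
      ≤ (1 + q.α / (2 * q.p) * (bif b then 1 else 0)) * ((1 / (n : ℝ)) *
            ∑ i, ‖q.α • c i (gradient (f i) s.w - s.hloc i)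
                - (gradient (f i) s.w - s.hloc i)‖ ^ 2)
          + (bif b then 1 else 0) * (1 + 1 / (q.α / (2 * q.p))) * ((1 / (n : ℝ)) *
            ∑ i, ‖gradient (f i) s.w - gradient (f i) s.y‖ ^ 2) := by
    have e : ∀ i, (adianaStep q f ψ c b s).hloc i - gradient (f i) s.w
        = q.α • c i (gradient (f i) s.w - s.hloc i) - (gradient (f i) s.w - s.hloc i) := by
      intro i; simp only [adianaStep]; abel
    cases b with
    | false =>
      have hw : (adianaStep q f ψ c false s).w = s.w := rfl
      simp only [hw, e]
      simp
    | true =>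
      have hw : (adianaStep q f ψ c true s).w = s.y := rfl
      simp only [hw, cond_true, mul_one, one_mul]
      rw [mul_left_comm, mul_left_comm (1 + 1 / _), ← mul_add]
      refine mul_le_mul_of_nonneg_left ?_ (by positivity)
      rw [Finset.mul_sum, Finset.mul_sum, ← Finset.sum_add_distrib]
      refine Finset.sum_le_sum fun i _ => ?_
      have e' : (adianaStep q f ψ c true s).hloc i - gradient (f i) s.y
          = (q.α • c i (gradient (f i) s.w - s.hloc i) - (gradient (f i) s.w - s.hloc i))
            + (gradient (f i) s.w - gradient (f i) s.y) := by
        rw [← e]; abel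
      rw [e']
      set a := q.α • c i (gradient (f i) s.w - s.hloc i) - (gradient (f i) s.w - s.hloc i)
      set v := gradient (f i) s.w - gradient (f i) s.y
      set σ := q.α / (2 * q.p)
      have hσ : 0 < σ := by positivity
      have h1 : ‖a + v‖ ≤ ‖a‖ + ‖v‖ := norm_add_le _ _
      have h2 : ‖a + v‖ ^ 2 ≤ (‖a‖ + ‖v‖) ^ 2 := by gcongr
      -- Weighted Young inequality. It is needed only when the coin succeeds, so `σ = α/(2p)` costs
      -- `σp = α/2` on average, half of the contraction of the shifts.
      have h3 : 0 ≤ 1 / σ * (σ * ‖a‖ - ‖v‖) ^ 2 := by positivity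
      have h4 : 1 / σ * (σ * ‖a‖ - ‖v‖) ^ 2
          = σ * ‖a‖ ^ 2 - 2 * (‖a‖ * ‖v‖) + 1 / σ * ‖v‖ ^ 2 := by
        field_simp; ring
      linarith
  have hh' := mul_le_mul_of_nonneg_left hh hq.hCoeff_nonneg
  have hz : (adianaStep q f ψ c b s).z
    = q.β • s.z + (1 - q.β) • x + (q.γ / q.η) • (yp - x) := rfl
  have hy : (adianaStep q f ψ c b s).y = yp := rfl
  rw [lyapunov, hw, hz, hy]
  simp only [avgBregman]
  linarith

end AdianaState.Valid

end Problem

/-! ### Moments of the compressors and of the coin. -/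

section Compressors

variable {d n : ℕ} {Ω : Type*} [MeasurableSpace Ω] {Pr : Measure Ω}

/-- Coordinate by coordinate this is additivity of the variance for pairwise independent real
variables. -/
theorem integral_norm_sum_sq [IsProbabilityMeasure Pr] {X : Fin n → Ω → Vec d}
    (hX : ∀ i, MemLp (X i) 2 Pr) (h0 : ∀ i, ∫ ω, X i ω ∂Pr = 0)
    (hind : Pairwise fun i j => IndepFun (X i) (X j) Pr) :
    ∫ ω, ‖∑ i, X i ω‖ ^ 2 ∂Pr = ∑ i, ∫ ω, ‖X i ω‖ ^ 2 ∂Pr := by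
  have hc : ∀ i a, MemLp (fun ω => X i ω a) 2 Pr := fun i a =>
    (EuclideanSpace.proj a : Vec d →L[ℝ] ℝ).comp_memLp' (hX i)
  have hc0 : ∀ i a, ∫ ω, X i ω a ∂Pr = 0 := by
    intro i a
    have := (EuclideanSpace.proj a : Vec d →L[ℝ] ℝ).integral_comp_comm
      ((hX i).integrable one_le_two)
    rw [h0 i, map_zero] at this
    exact this
  have hcsq : ∀ i a, Integrable (fun ω => X i ω a ^ 2) Pr := fun i a => (hc i a).integrable_sq
  have hs : ∀ a, MemLp (∑ i, fun ω => X i ω a) 2 Pr := fun a => memLp_finsetSum' _ fun i _ => hc i a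
  have key : ∀ a, ∫ ω, (∑ i, X i ω a) ^ 2 ∂Pr = ∑ i, ∫ ω, X i ω a ^ 2 ∂Pr := by
    intro a
    have h1 := IndepFun.variance_sum (μ := Pr) (X := fun i ω => X i ω a) (s := Finset.univ)
      (fun i _ => hc i a) (fun i _ j _ hij =>
        (hind hij).comp (φ := fun v : Vec d => v a) (ψ := fun v : Vec d => v a)
          (by fun_prop) (by fun_prop))
    have h2 : ∫ ω, (∑ i, fun ω => X i ω a) ω ∂Pr = 0 := by
      simp only [Finset.sum_apply]
      rw [integral_finsetSum _ fun i _ => (hc i a).integrable one_le_two]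
      simp [hc0]
    rw [variance_of_integral_eq_zero (hs a).aestronglyMeasurable.aemeasurable h2] at h1
    simp only [Finset.sum_apply] at h1
    rw [h1]
    exact Finset.sum_congr rfl fun i _ =>
      variance_of_integral_eq_zero (hc i a).aestronglyMeasurable.aemeasurable (hc0 i a)
  simp only [EuclideanSpace.real_norm_sq_eq]
  rw [integral_finsetSum]
  · simp_rw [WithLp.ofLp_sum, Finset.sum_apply]
    simp_rw [key]
    rw [Finset.sum_comm]
    refine Finset.sum_congr rfl fun i _ => ?_
    rw [integral_finsetSum _ fun a _ => hcsq i a]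
  · intro a _
    have := (hs a).integrable_sq
    simpa [Finset.sum_apply] using this

namespace IsCompressor

variable {ω : ℝ} {S : Type*} [MeasurableSpace S]

theorem comp_seed {seed : Ω → S} (hseed : Measurable seed) {c : S → Vec d → Vec d}
    (h : IsCompressor ω (Pr.map seed) c) : IsCompressor ω Pr fun s => c (seed s) where
  measurable := h.measurable.comp ((hseed.comp measurable_fst).prodMk measurable_snd)
  integrable x := (h.integrable x).comp_measurable hseed
  unbiased x := by
    rw [← integral_map hseed.aemeasurable (h.integrable x).aestronglyMeasurable]
    exact h.unbiased x
  integrable_sq x := (h.integrable_sq x).comp_measurable hseed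
  variance_le x := by
    rw [← integral_map hseed.aemeasurable (f := fun s => ‖c s x - x‖ ^ 2)
      (h.integrable_sq x).aestronglyMeasurable]
    exact h.variance_le x

variable {c : Ω → Vec d → Vec d}

theorem measurable_apply (h : IsCompressor ω Pr c) (v : Vec d) : Measurable fun s => c s v :=
  h.measurable.comp (measurable_id.prodMk measurable_const)

theorem memLp_sub (h : IsCompressor ω Pr c) (v : Vec d) : MemLp (fun s => c s v - v) 2 Pr := by
  rw [memLp_two_iff_integrable_sq_norm]
  · exact h.integrable_sq v
  · exact ((h.measurable_apply v).sub_const v).aestronglyMeasurable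

theorem integral_sub [IsProbabilityMeasure Pr] (h : IsCompressor ω Pr c) (v : Vec d) :
    ∫ s, (c s v - v) ∂Pr = 0 := by
  rw [MeasureTheory.integral_sub (h.integrable v) (integrable_const v), h.unbiased v]
  simp

theorem integrable_shift [IsProbabilityMeasure Pr] (h : IsCompressor ω Pr c) (α : ℝ) (v : Vec d) :
    Integrable (fun s => ‖α • c s v - v‖ ^ 2) Pr := by
  have : MemLp (fun s => α • c s v - v) 2 Pr := by
    have := ((h.memLp_sub v).const_smul α).add (memLp_const ((α - 1) • v))
    refine this.congr_norm ?_ (Filter.Eventually.of_forall fun s => ?_)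
    · exact (((h.measurable_apply v).const_smul α).sub_const v).aestronglyMeasurable
    · simp only [Pi.add_apply, Pi.smul_apply]
      congr 1
      module
  exact this.integrable_norm_pow two_ne_zero

/-- With the bias `(α - 1)v` split off, the cross term has mean zero and `α²ω + (1-α)² = 1 - α`
precisely because `α(ω+1) = 1`. -/
theorem integral_shift_le [IsProbabilityMeasure Pr] (h : IsCompressor ω Pr c) {α : ℝ}
    (hα : α * (ω + 1) = 1) (v : Vec d) :
    ∫ s, ‖α • c s v - v‖ ^ 2 ∂Pr ≤ (1 - α) * ‖v‖ ^ 2 := by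
  have e : ∀ s, ‖α • c s v - v‖ ^ 2
      = α ^ 2 * ‖c s v - v‖ ^ 2 + 2 * α * (α - 1) * inner ℝ v (c s v - v)
        + (1 - α) ^ 2 * ‖v‖ ^ 2 := by
    intro s
    have : α • c s v - v = α • (c s v - v) + (α - 1) • v := by module
    rw [this, norm_add_sq_real, norm_smul, norm_smul, real_inner_smul_left, real_inner_smul_right,
      mul_pow, mul_pow, Real.norm_eq_abs, Real.norm_eq_abs, sq_abs, sq_abs, real_inner_comm]
    ring
  have hi : Integrable (fun s => c s v - v) Pr := (h.memLp_sub v).integrable one_le_two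
  have h0 : ∫ s, inner ℝ v (c s v - v) ∂Pr = 0 := by
    rw [integral_inner hi, h.integral_sub v, inner_zero_right]
  simp_rw [e]
  rw [integral_add (((h.integrable_sq v).const_mul _).fun_add ((hi.const_inner v).const_mul _))
      (integrable_const _), integral_add ((h.integrable_sq v).const_mul _)
      ((hi.const_inner v).const_mul _), integral_const_mul, integral_const_mul, h0, integral_const]
  have h1 := mul_le_mul_of_nonneg_left (h.variance_le v) (sq_nonneg α)
  simp only [probReal_univ, smul_eq_mul, one_mul, mul_zero, add_zero]
  have h2 : α ^ 2 * (ω * ‖v‖ ^ 2) = (α - α ^ 2) * ‖v‖ ^ 2 := by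
    linear_combination α * ‖v‖ ^ 2 * hα
  rw [h2] at h1
  linarith

end IsCompressor

/-- The error of the average of independent compressors. -/
theorem integral_norm_average_sq_le [IsProbabilityMeasure Pr] {ω : ℝ}
    {c : Fin n → Ω → Vec d → Vec d} (hc : ∀ i, IsCompressor ω Pr (c i)) (v : Fin n → Vec d)
    (hind : Pairwise fun i j => IndepFun (fun s => c i s (v i)) (fun s => c j s (v j)) Pr) :
    ∫ s, ‖(1 / (n : ℝ)) • ∑ i, (c i s (v i) - v i)‖ ^ 2 ∂Pr
      ≤ ω / n * ((1 / (n : ℝ)) * ∑ i, ‖v i‖ ^ 2) := by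
  simp_rw [norm_smul, mul_pow]
  rw [integral_const_mul, integral_norm_sum_sq (X := fun i s => c i s (v i) - v i)
    (fun i => (hc i).memLp_sub (v i)) (fun i => (hc i).integral_sub (v i))
    (fun i j hij => (hind hij).comp (φ := fun u => u - v i) (ψ := fun u => u - v j)
      (by fun_prop) (by fun_prop))]
  calc ‖1 / (n : ℝ)‖ ^ 2 * ∑ i, ∫ s, ‖c i s (v i) - v i‖ ^ 2 ∂Pr
      ≤ ‖1 / (n : ℝ)‖ ^ 2 * ∑ i, ω * ‖v i‖ ^ 2 := by
        gcongr with i; exact (hc i).variance_le (v i)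
    _ = _ := by
        rw [← Finset.mul_sum, Real.norm_eq_abs, sq_abs]; ring

theorem integral_coin [IsProbabilityMeasure Pr] {coin : Ω → Bool} (hcoin : Measurable coin)
    {p : ℝ} (hp : 0 ≤ p) (h : Pr {s | coin s = true} = ENNReal.ofReal p) :
    Integrable (fun s => (bif coin s then 1 else 0 : ℝ)) Pr ∧
      ∫ s, (bif coin s then 1 else 0 : ℝ) ∂Pr = p := by
  have hm : MeasurableSet {s | coin s = true} := hcoin (measurableSet_singleton true)
  have e : (fun s => (bif coin s then 1 else 0 : ℝ)) = {s | coin s = true}.indicator 1 := by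
    ext s
    cases hs : coin s <;> simp [hs]
  rw [e]
  refine ⟨(integrable_const (1 : ℝ)).indicator hm, ?_⟩
  rw [integral_indicator_one hm, measureReal_def, h, ENNReal.toReal_ofReal hp]

end Compressors

/-! ### Expected contraction from a fixed state. -/

section ConditionalStep

variable {d n : ℕ} {Ω : Type*} [MeasurableSpace Ω] {Pr : Measure Ω} [IsProbabilityMeasure Pr]
  {f : Fin n → Vec d → ℝ} {ψ : Vec d → EReal} {L μ ω : ℝ} {xs : Vec d}
  {q : AdianaParams} {s : AdianaState d n}

/-- The Lyapunov function contracts in expectation along one step from a fixed state. -/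
theorem AdianaState.Valid.lintegral_lyapunov_step_le (hs : s.Valid ψ)
    (P : IsCompositeProblem f ψ L μ xs) (hq : q.Admissible n ω L μ)
    {S : Type*} [MeasurableSpace S] {seed : Fin n → Ω → S} {coin : Ω → Bool}
    {C : Fin n → S → Vec d → Vec d} (hseed : ∀ i, Measurable (seed i)) (hcoin : Measurable coin)
    (hind : iIndepFun seed Pr) (hsc : IndepFun (fun o i => seed i o) coin Pr)
    (hp : Pr {o | coin o = true} = ENNReal.ofReal q.p)
    (hC : ∀ i, IsCompressor ω (Pr.map (seed i)) (C i)) :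
    ∫⁻ o, ENNReal.ofReal (lyapunov q ω f ψ xs
        (adianaStep q f ψ (fun i => C i (seed i o)) (coin o) s)) ∂Pr
      ≤ ENNReal.ofReal ((1 - q.rate μ) * lyapunov q ω f ψ xs s) := by
  have hn : (0 : ℝ) < n := Nat.cast_pos.2 hq.n_pos
  have hc : ∀ i, IsCompressor ω Pr fun o => C i (seed i o) := fun i => (hC i).comp_seed (hseed i)
  have hCm : ∀ i v, Measurable fun t => C i t v := fun i v =>
    (hC i).measurable.comp (measurable_id.prodMk measurable_const)
  set x := s.query q with hx
  set v : Fin n → Vec d := fun i => gradient (f i) x - s.hloc i with hv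
  set u : Fin n → Vec d := fun i => gradient (f i) s.w - s.hloc i with hu
  set A : ℝ := q.β * ‖s.z - xs‖ ^ 2
          + 2 * q.γ * q.wWeight * (objGap f ψ xs s.w - avgBregman f s.w x)
          + 2 * q.γ * q.yWeight * (objGap f ψ xs s.y - avgBregman f s.y x) with hA
  set ξ : Ω → Vec d := fun o => (1 / (n : ℝ)) • ∑ i, (C i (seed i o) (v i) - v i) with hξ
  set e : Vec d := (xs - x) + q.wWeight • (s.w - x) + q.yWeight • (s.y - x) with he
  set B : Ω → ℝ := fun o => bif coin o then 1 else 0 with hB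
  set Q : Ω → ℝ := fun o => (1 / (n : ℝ)) * ∑ i, ‖q.α • C i (seed i o) (u i) - u i‖ ^ 2 with hQ
  set R : ℝ := (1 / (n : ℝ)) * ∑ i, ‖gradient (f i) s.w - gradient (f i) s.y‖ ^ 2 with hR
  set σ := q.α / (2 * q.p) with hσ
  set gy := objGap f ψ xs s.y with hgy
  set gw := objGap f ψ xs s.w with hgw
  obtain ⟨hBi, hBe⟩ := integral_coin hcoin hq.p_pos.le hp
  change ∫ o, B o ∂Pr = q.p at hBe
  -- the noise of the gradient estimate
  have hξL : MemLp ξ 2 Pr :=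
    (memLp_finsetSum _ fun i _ => (hc i).memLp_sub (v i)).const_smul (1 / (n : ℝ))
  have hξi : Integrable ξ Pr := hξL.integrable one_le_two
  have hξ0 : ∫ o, ξ o ∂Pr = 0 := by
    simp only [hξ]
    rw [integral_smul, integral_finsetSum _ fun i _ => ((hc i).memLp_sub (v i)).integrable one_le_two]
    simp [fun i => (hc i).integral_sub (v i)]
  have hξe : ∫ o, inner ℝ (ξ o) e ∂Pr = 0 := by
    simp_rw [real_inner_comm e]
    rw [integral_inner hξi, hξ0, inner_zero_right]
  have hξV := integral_norm_average_sq_le hc v (fun i j hij =>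
    (hind.indepFun hij).comp (hCm i (v i)) (hCm j (v j)))
  -- the error of the new shifts
  have hQi : Integrable Q Pr :=
    (integrable_finsetSum _ fun i _ => (hc i).integrable_shift q.α (u i)).const_mul _
  set S₀ : ℝ := (1 / (n : ℝ)) * ∑ i, ‖s.hloc i - gradient (f i) s.w‖ ^ 2 with hS₀
  have hS₀u : S₀ = (1 / (n : ℝ)) * ∑ i, ‖u i‖ ^ 2 := by
    simp only [hS₀, hu, norm_sub_rev]
  have hQe : ∫ o, Q o ∂Pr ≤ (1 - q.α) * S₀ := by
    simp only [hQ]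
    rw [integral_const_mul, integral_finsetSum _ fun i _ => (hc i).integrable_shift q.α (u i),
      hS₀u, mul_left_comm (1 - q.α)]
    refine mul_le_mul_of_nonneg_left ?_ (by positivity)
    rw [Finset.mul_sum]
    refine Finset.sum_le_sum fun i _ => ?_
    exact (hc i).integral_shift_le hq.α_mul (u i)
  -- The only product of two random quantities in the bound is coin times shift error. Noise and
  -- shift error share compressor realizations, but they enter additively, so their dependence is
  -- harmless.
  have hBQ : IndepFun B Q Pr := by
    have h1 : Measurable fun t : Fin n → S =>
        (1 / (n : ℝ)) * ∑ i, ‖q.α • C i (t i) (u i) - u i‖ ^ 2 := by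
      refine (Finset.measurable_sum _ fun i _ => ?_).const_mul _
      exact ((((hCm i (u i)).comp (measurable_pi_apply i)).const_smul q.α).sub_const _).norm.pow_const 2
    exact hsc.symm.comp (φ := fun b => (bif b then 1 else 0 : ℝ)) (measurable_of_countable _) h1
  have hBQi : Integrable (fun o => B o * Q o) Pr := hBQ.integrable_mul hBi hQi
  have hBQe : ∫ o, B o * Q o ∂Pr = q.p * ∫ o, Q o ∂Pr := by
    rw [hBQ.integral_fun_mul_eq_mul_integral hBi.aestronglyMeasurable hQi.aestronglyMeasurable]
    exact congrArg (· * _) hBe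
  -- the pointwise bound and its integral
  set F : Ω → ℝ := fun o => (A + q.wCoeff * gw) + 2 * q.γ * inner ℝ (ξ o) e
      + q.γ * q.totalWeight * q.η * ‖ξ o‖ ^ 2
      + (q.wCoeff * (gy - gw) + q.hCoeff n ω * ((1 + 1 / σ) * R)) * B o
      + q.hCoeff n ω * Q o + q.hCoeff n ω * σ * (B o * Q o) with hF
  have i1 : Integrable (fun o => 2 * q.γ * inner ℝ (ξ o) e) Pr := (hξi.inner_const e).const_mul _
  have i2 : Integrable (fun o => q.γ * q.totalWeight * q.η * ‖ξ o‖ ^ 2) Pr :=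
    (hξL.integrable_norm_pow two_ne_zero).const_mul _
  have i3 : Integrable (fun o => (q.wCoeff * (gy - gw) + q.hCoeff n ω * ((1 + 1 / σ) * R)) * B o)
      Pr := hBi.const_mul _
  have i4 := hQi.const_mul (q.hCoeff n ω)
  have i5 := hBQi.const_mul (q.hCoeff n ω * σ)
  have i0 : Integrable (fun _ : Ω => A + q.wCoeff * gw) Pr := integrable_const _
  have hFi : Integrable F Pr := ((((i0.add i1).add i2).add i3).add i4).add i5
  have hle : ∀ o, lyapunov q ω f ψ xs (adianaStep q f ψ (fun i => C i (seed i o)) (coin o) s)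
      ≤ F o := by
    intro o
    refine (hs.lyapunov_step_le P hq (fun i => C i (seed i o)) (coin o)).trans (le_of_eq ?_)
    simp only [hF, hB, hQ, hξ, hA]
    ring
  have hnn : ∀ o, 0 ≤ F o := fun o => le_trans ((sq_nonneg _).trans
    ((hs.step P.proper (P.isProx_prox hq.η_pos hq.η_mul_L_le) _ _).lyapunov_ge P hq)) (hle o)
  refine (lintegral_mono fun o => ENNReal.ofReal_le_ofReal (hle o)).trans ?_
  rw [← ofReal_integral_eq_lintegral_ofReal hFi (Filter.Eventually.of_forall hnn)]
  refine ENNReal.ofReal_le_ofReal ?_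
  have hFe : ∫ o, F o ∂Pr = (A + q.wCoeff * gw)
      + q.γ * q.totalWeight * q.η * ∫ o, ‖ξ o‖ ^ 2 ∂Pr
      + (q.wCoeff * (gy - gw) + q.hCoeff n ω * ((1 + 1 / σ) * R)) * q.p
      + q.hCoeff n ω * (∫ o, Q o ∂Pr) + q.hCoeff n ω * σ * (q.p * ∫ o, Q o ∂Pr) := by
    simp only [hF]
    rw [integral_add ((((i0.fun_add i1).fun_add i2).fun_add i3).fun_add i4) i5,
      integral_add (((i0.fun_add i1).fun_add i2).fun_add i3) i4,
      integral_add ((i0.fun_add i1).fun_add i2) i3, integral_add (i0.fun_add i1) i2, integral_add i0 i1,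
      integral_const_mul (q.hCoeff n ω * σ) (fun o => B o * Q o),
      integral_const_mul (q.hCoeff n ω) Q, integral_const_mul,
      integral_const_mul, integral_const_mul _ B, hξe, hBQe, hBe]
    simp
  have hDw := P.avgBregman_nonneg hq.μ_pos.le s.w x
  have hDy := P.avgBregman_nonneg hq.μ_pos.le s.y x
  have hT := P.sum_norm_gradient_sub_sq_le hq.L_pos s.w x
  have hT' := P.sum_norm_gradient_sub_sq_le hq.L_pos s.y x
  have hsq : ∀ a b : Vec d, ‖a - b‖ ^ 2 ≤ 2 * ‖a‖ ^ 2 + 2 * ‖b‖ ^ 2 := by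
    intro a b
    have := parallelogram_law_with_norm ℝ a b
    nlinarith [mul_self_nonneg ‖a + b‖]
  -- `∇f_i(x) - h_i` is split at `∇f_i(w)`: the shift error remains, and the gradient difference is
  -- bounded by the divergence at `w`.
  have hVb : ω / n * ((1 / (n : ℝ)) * ∑ i, ‖v i‖ ^ 2)
      ≤ 2 * ω / n * (2 * L * avgBregman f s.w x + S₀) := by
    have h1 : (1 / (n : ℝ)) * ∑ i, ‖v i‖ ^ 2 ≤ 2 * ((1 / (n : ℝ)) *
        ∑ i, ‖gradient (f i) s.w - gradient (f i) x‖ ^ 2) + 2 * S₀ := by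
      rw [hS₀u, mul_left_comm 2, mul_left_comm 2, ← mul_add]
      refine mul_le_mul_of_nonneg_left ?_ (by positivity)
      rw [Finset.mul_sum, Finset.mul_sum, ← Finset.sum_add_distrib]
      refine Finset.sum_le_sum fun i _ => ?_
      have := hsq (u i) (gradient (f i) s.w - gradient (f i) x)
      have e1 : u i - (gradient (f i) s.w - gradient (f i) x) = v i := by
        simp only [hu, hv]; abel
      rw [e1] at this
      linarith
    have h2 : 0 ≤ ω / n := div_nonneg hq.ω_nonneg hn.le
    calc ω / n * ((1 / (n : ℝ)) * ∑ i, ‖v i‖ ^ 2)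
        ≤ ω / n * (2 * (2 * L * avgBregman f s.w x) + 2 * S₀) := by
          refine mul_le_mul_of_nonneg_left (h1.trans ?_) h2
          linarith
      _ = _ := by ring
  -- The gradients at `w` and `y` are compared through `x`, so that only divergences based at `x`
  -- occur.
  have hRb : R ≤ 4 * L * (avgBregman f s.w x + avgBregman f s.y x) := by
    have h1 : R ≤ 2 * ((1 / (n : ℝ)) * ∑ i, ‖gradient (f i) s.w - gradient (f i) x‖ ^ 2)
        + 2 * ((1 / (n : ℝ)) * ∑ i, ‖gradient (f i) s.y - gradient (f i) x‖ ^ 2) := by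
      rw [hR, mul_left_comm 2, mul_left_comm 2, ← mul_add]
      refine mul_le_mul_of_nonneg_left ?_ (by positivity)
      rw [Finset.mul_sum, Finset.mul_sum, ← Finset.sum_add_distrib]
      refine Finset.sum_le_sum fun i _ => ?_
      have := hsq (gradient (f i) s.w - gradient (f i) x) (gradient (f i) s.y - gradient (f i) x)
      rwa [sub_sub_sub_cancel_right] at this
    linarith
  have hS₀0 : 0 ≤ S₀ := by positivity
  have final := hq.expected_bound_le (gy := gy) (gw := gw) (S := S₀) (R := R)
    (V := ∫ o, ‖ξ o‖ ^ 2 ∂Pr) (Z := ‖s.z - xs‖ ^ 2) (sq_nonneg _)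
    (P.objGap_nonneg hs.y_ne_top) (P.objGap_nonneg hs.w_ne_top) hS₀0 hDw hDy
    (hξV.trans hVb) hRb
  have hσ0 : 0 < σ := div_pos hq.α_pos (mul_pos two_pos hq.p_pos)
  have hQe' := mul_le_mul_of_nonneg_left hQe
    (mul_nonneg hq.hCoeff_nonneg (by have := hq.p_pos; positivity : 0 ≤ 1 + σ * q.p))
  rw [hFe]
  refine le_trans ?_ final
  rw [hA, ← hσ]
  linear_combination hQe'

end ConditionalStep

/-! ### Measurability of the algorithm. -/

section Measurability

variable {d n : ℕ}

instance AdianaState.measurableSpace : MeasurableSpace (AdianaState d n) :=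
  MeasurableSpace.comap (fun s => (s.z, s.y, s.w, s.hloc, s.h)) inferInstance

namespace AdianaState

theorem measurable_iff {T : Type*} [MeasurableSpace T] {g : T → AdianaState d n} :
    Measurable g ↔ Measurable (fun t => ((g t).z, (g t).y, (g t).w, (g t).hloc, (g t).h)) :=
  measurable_comap_iff

theorem measurable_fields :
    Measurable (fun s : AdianaState d n => (s.z, s.y, s.w, s.hloc, s.h)) :=
  measurable_iff.1 measurable_id

theorem measurable_z : Measurable (fun s : AdianaState d n => s.z) := measurable_fields.fst

theorem measurable_y : Measurable (fun s : AdianaState d n => s.y) := measurable_fields.snd.fst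

theorem measurable_w : Measurable (fun s : AdianaState d n => s.w) := measurable_fields.snd.snd.fst

theorem measurable_hloc (i : Fin n) : Measurable (fun s : AdianaState d n => s.hloc i) :=
  (measurable_pi_apply i).comp measurable_fields.snd.snd.snd.fst

theorem measurable_h : Measurable (fun s : AdianaState d n => s.h) :=
  measurable_fields.snd.snd.snd.snd

end AdianaState

variable {f : Fin n → Vec d → ℝ} {ψ : Vec d → EReal} {L μ ω : ℝ} {xs : Vec d} {q : AdianaParams}

namespace IsCompositeProblem

theorem measurable_objGap (P : IsCompositeProblem f ψ L μ xs) : Measurable (objGap f ψ xs) := by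
  have h1 : Measurable (avgLoss f) := by
    have : Continuous (avgLoss f) :=
      continuous_iff_continuousAt.2 fun x => (P.hasGradientAt_avgLoss x).hasFDerivAt.continuousAt
    exact this.measurable
  exact ((h1.coe_real_ereal.add P.proper.closed.measurable).ereal_toReal).sub_const _

theorem measurable_lyapunov (P : IsCompositeProblem f ψ L μ xs) :
    Measurable (lyapunov q ω f ψ xs) := by
  have hG := fun i => (P.continuous_gradient i).measurable
  have h1 := ((AdianaState.measurable_z (d := d) (n := n)).sub_const xs).norm.pow_const 2
  have h2 := (P.measurable_objGap.comp (AdianaState.measurable_y (n := n))).const_mul q.yCoeff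
  have h3 := (P.measurable_objGap.comp (AdianaState.measurable_w (n := n))).const_mul q.wCoeff
  have h4 : Measurable fun s : AdianaState d n =>
      ∑ i, ‖s.hloc i - gradient (f i) s.w‖ ^ 2 :=
    Finset.measurable_sum _ fun i _ => ((AdianaState.measurable_hloc i).sub
      ((hG i).comp AdianaState.measurable_w)).norm.pow_const 2
  exact ((h1.add h2).add h3).add ((h4.const_mul _).const_mul _)

theorem measurable_adianaStep (P : IsCompositeProblem f ψ L μ xs) (hη : 0 < q.η)
    (hL : q.η * L ≤ 1 / 2) {S : Type*} [MeasurableSpace S] {C : Fin n → S → Vec d → Vec d}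
    (hC : ∀ i, Measurable (Function.uncurry (C i))) :
    Measurable fun t : AdianaState d n × ((Fin n → S) × Bool) =>
      adianaStep q f ψ (fun i => C i (t.2.1 i)) t.2.2 t.1 := by
  have hG := fun i => (P.continuous_gradient i).measurable
  have hprox : Measurable (prox q.η ψ) :=
    (continuous_prox P.proper hη (P.isProx_prox hη hL)).measurable
  have mfst : Measurable (Prod.fst :
      AdianaState d n × ((Fin n → S) × Bool) → AdianaState d n) := measurable_fst
  have mz := AdianaState.measurable_z.comp mfst
  have my := AdianaState.measurable_y.comp mfst
  have mw := AdianaState.measurable_w.comp mfst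
  have mh := AdianaState.measurable_h.comp mfst
  have ml := fun i => (AdianaState.measurable_hloc i).comp mfst
  have ms : ∀ i, Measurable fun t : AdianaState d n × ((Fin n → S) × Bool) => t.2.1 i := fun i =>
    (measurable_pi_apply i).comp (measurable_fst.comp measurable_snd)
  have mb : Measurable fun t : AdianaState d n × ((Fin n → S) × Bool) => t.2.2 :=
    measurable_snd.comp measurable_snd
  have mx : Measurable fun t : AdianaState d n × ((Fin n → S) × Bool) => t.1.query q :=
    ((mz.const_smul q.θ₁).add (mw.const_smul q.θ₂)).add (my.const_smul (1 - q.θ₁ - q.θ₂))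
  have mcx : ∀ i, Measurable fun t : AdianaState d n × ((Fin n → S) × Bool) =>
      C i (t.2.1 i) (gradient (f i) (t.1.query q) - t.1.hloc i) := fun i =>
    (hC i).comp ((ms i).prodMk (((hG i).comp mx).sub (ml i)))
  have mcw : ∀ i, Measurable fun t : AdianaState d n × ((Fin n → S) × Bool) =>
      C i (t.2.1 i) (gradient (f i) t.1.w - t.1.hloc i) := fun i =>
    (hC i).comp ((ms i).prodMk (((hG i).comp mw).sub (ml i)))
  have my' : Measurable fun t : AdianaState d n × ((Fin n → S) × Bool) =>
      (adianaStep q f ψ (fun i => C i (t.2.1 i)) t.2.2 t.1).y :=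
    hprox.comp (mx.sub ((((Finset.measurable_sum _ fun i _ => mcx i).const_smul
      (1 / (n : ℝ))).add mh).const_smul q.η))
  rw [AdianaState.measurable_iff]
  refine Measurable.prodMk ?_ (my'.prodMk (Measurable.prodMk ?_ (Measurable.prodMk ?_ ?_)))
  · exact ((mz.const_smul q.β).add (mx.const_smul (1 - q.β))).add
      ((my'.sub mx).const_smul (q.γ / q.η))
  · exact Measurable.ite (mb (measurableSet_singleton true)) my mw
  · exact measurable_pi_lambda _ fun i => (ml i).add ((mcw i).const_smul q.α)
  · exact mh.add (((Finset.measurable_sum _ fun i _ => mcw i).const_smul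
      (1 / (n : ℝ))).const_smul q.α)

end IsCompositeProblem

end Measurability

/-! ### Independence of past and present randomness, and iteration of the contraction. -/

section Independence

variable {Ω : Type*} [MeasurableSpace Ω] {Pr : Measure Ω} [IsProbabilityMeasure Pr]

/-- Under these hypotheses the joint law is the product of the four marginals, and Tonelli allows
exchanging the roles of `B` and `C`. This regroups seeds versus coins into past versus present. -/
theorem ProbabilityTheory.IndepFun.prodMk_prodMk_of_indepFun {α β γ δ : Type*} [MeasurableSpace α]
    [MeasurableSpace β] [MeasurableSpace γ] [MeasurableSpace δ]
    {A : Ω → α} {B : Ω → β} {C : Ω → γ} {D : Ω → δ} (hA : Measurable A) (hB : Measurable B)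
    (hC : Measurable C) (hD : Measurable D) (hAB : IndepFun A B Pr) (hCD : IndepFun C D Pr)
    (h : IndepFun (fun o => (A o, B o)) (fun o => (C o, D o)) Pr) :
    IndepFun (fun o => (A o, C o)) (fun o => (B o, D o)) Pr := by
  have hAC : IndepFun A C Pr := h.comp measurable_fst measurable_fst
  have hBD : IndepFun B D Pr := h.comp measurable_snd measurable_snd
  rw [indepFun_iff_map_prod_eq_prod_map_map (by fun_prop) (by fun_prop)] at *
  rw [hAC, hBD]
  rw [hAB, hCD] at h
  have := Measure.isProbabilityMeasure_map (μ := Pr) hA.aemeasurable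
  have := Measure.isProbabilityMeasure_map (μ := Pr) hB.aemeasurable
  have := Measure.isProbabilityMeasure_map (μ := Pr) hC.aemeasurable
  have := Measure.isProbabilityMeasure_map (μ := Pr) hD.aemeasurable
  refine Measure.ext_of_lintegral _ fun g hg => ?_
  have e : Pr.map (fun o => ((A o, C o), (B o, D o)))
      = (Pr.map fun o => ((A o, B o), (C o, D o))).map
        (fun t : (α × β) × (γ × δ) => ((t.1.1, t.2.1), (t.1.2, t.2.2))) := by
    rw [Measure.map_map (by fun_prop) (by fun_prop)]
    rfl
  rw [e, h, lintegral_map hg (by fun_prop), lintegral_prod _ (by fun_prop),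
    lintegral_prod _ (by fun_prop), lintegral_prod _ (by fun_prop), lintegral_prod _ (by fun_prop)]
  refine lintegral_congr fun a => ?_
  have e1 : ∀ b, ∫⁻ cd, g ((a, cd.1), (b, cd.2)) ∂((Pr.map C).prod (Pr.map D))
      = ∫⁻ c, ∫⁻ d', g ((a, c), (b, d')) ∂(Pr.map D) ∂(Pr.map C) := fun b =>
    lintegral_prod _ (by fun_prop)
  have e2 : ∀ c, ∫⁻ bd, g ((a, c), bd) ∂((Pr.map B).prod (Pr.map D))
      = ∫⁻ b, ∫⁻ d', g ((a, c), (b, d')) ∂(Pr.map D) ∂(Pr.map B) := fun c =>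
    lintegral_prod _ (by fun_prop)
  simp_rw [e1, e2]
  refine lintegral_lintegral_swap ?_
  refine (Measurable.lintegral_prod_right' (f := fun t : (β × γ) × δ =>
    g ((a, t.1.2), (t.1.1, t.2))) (by fun_prop)).aemeasurable

variable {d n : ℕ} {f : Fin n → Vec d → ℝ} {ψ : Vec d → EReal} {L μ ω : ℝ} {xs : Vec d}
  {q : AdianaParams} {S : Type*} [MeasurableSpace S] {seed : ℕ → Fin n → Ω → S}
  {coin : ℕ → Ω → Bool} {C : ℕ → Fin n → S → Vec d → Vec d}

/-- The state after `k` iterations is a measurable function of the first `k` seeds and coins. -/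
theorem IsCompositeProblem.exists_measurable_adianaIter_eq (P : IsCompositeProblem f ψ L μ xs)
    (hη : 0 < q.η) (hL : q.η * L ≤ 1 / 2) (x₀ : Vec d) (h₀ : Fin n → Vec d)
    (hC : ∀ k i, Measurable (Function.uncurry (C k i))) (k : ℕ) :
    ∃ Φ : ((Finset.range k ×ˢ Finset.univ : Finset (ℕ × Fin n)) → S) × (Finset.range k → Bool) →
        AdianaState d n, Measurable Φ ∧ ∀ (σ : ℕ → Fin n → S) (b : ℕ → Bool),
      adianaIter q f ψ x₀ h₀ (fun k i => C k i (σ k i)) b k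
        = Φ (fun j => σ j.1.1 j.1.2, fun j => b j) := by
  induction k with
  | zero => exact ⟨fun _ => adianaInit x₀ h₀, measurable_const, fun σ b => rfl⟩
  | succ k ih =>
    obtain ⟨Φ, hΦ, he⟩ := ih
    have hsub : ∀ j : (Finset.range k ×ˢ Finset.univ : Finset (ℕ × Fin n)),
        j.1 ∈ (Finset.range (k + 1) ×ˢ Finset.univ : Finset (ℕ × Fin n)) := by
      rintro ⟨j, hj⟩
      simp only [Finset.mem_product, Finset.mem_range, Finset.mem_univ, and_true] at hj ⊢
      omega
    have hsub' : ∀ j : Finset.range k, j.1 ∈ Finset.range (k + 1) := by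
      rintro ⟨j, hj⟩
      simp only [Finset.mem_range] at hj ⊢
      omega
    have hlast : ∀ i : Fin n, (k, i) ∈ (Finset.range (k + 1) ×ˢ Finset.univ :
        Finset (ℕ × Fin n)) := fun i => by simp
    have m1 : Measurable fun t : ((Finset.range (k + 1) ×ˢ Finset.univ :
        Finset (ℕ × Fin n)) → S) × (Finset.range (k + 1) → Bool) =>
        ((fun j => t.1 ⟨j.1, hsub j⟩ :
            (Finset.range k ×ˢ Finset.univ : Finset (ℕ × Fin n)) → S),
          (fun j => t.2 ⟨j.1, hsub' j⟩ : Finset.range k → Bool)) :=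
      Measurable.prodMk
        (measurable_pi_lambda _ fun j => (measurable_pi_apply _).comp measurable_fst)
        (measurable_pi_lambda _ fun j => (measurable_pi_apply _).comp measurable_snd)
    have m2 : Measurable fun t : ((Finset.range (k + 1) ×ˢ Finset.univ :
        Finset (ℕ × Fin n)) → S) × (Finset.range (k + 1) → Bool) =>
        ((fun i => t.1 ⟨(k, i), hlast i⟩ : Fin n → S), t.2 ⟨k, by simp⟩) :=
      Measurable.prodMk
        (measurable_pi_lambda _ fun i => (measurable_pi_apply _).comp measurable_fst)
        ((measurable_pi_apply _).comp measurable_snd)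
    have m3 := (hΦ.comp m1).prodMk m2
    refine ⟨_, (P.measurable_adianaStep hη hL (hC k)).comp m3, fun σ b => ?_⟩
    rw [adianaIter, he σ b]
    rfl

theorem IsCompositeProblem.measurable_adianaIter (P : IsCompositeProblem f ψ L μ xs)
    (hη : 0 < q.η) (hL : q.η * L ≤ 1 / 2) (x₀ : Vec d) (h₀ : Fin n → Vec d)
    (hseed : ∀ k i, Measurable (seed k i)) (hcoin : ∀ k, Measurable (coin k))
    (hC : ∀ k i, Measurable (Function.uncurry (C k i))) (k : ℕ) :
    Measurable fun o =>
      adianaIter q f ψ x₀ h₀ (fun k i => C k i (seed k i o)) (fun k => coin k o) k := by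
  obtain ⟨Φ, hΦ, he⟩ := P.exists_measurable_adianaIter_eq hη hL x₀ h₀ hC k
  simp_rw [fun o => he (fun k i => seed k i o) fun k => coin k o]
  exact hΦ.comp (Measurable.prodMk (measurable_pi_lambda _ fun j => hseed _ _)
    (measurable_pi_lambda _ fun j => hcoin _))

/-- The state after `k` iterations is independent of the randomness of iteration `k`. -/
theorem IsCompositeProblem.indepFun_adianaIter (P : IsCompositeProblem f ψ L μ xs)
    (hη : 0 < q.η) (hL : q.η * L ≤ 1 / 2) (x₀ : Vec d) (h₀ : Fin n → Vec d)
    (hseed : ∀ k i, Measurable (seed k i)) (hcoin : ∀ k, Measurable (coin k))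
    (hs : iIndepFun (fun (j : ℕ × Fin n) => seed j.1 j.2) Pr) (hc : iIndepFun coin Pr)
    (hsc : IndepFun (fun (o : Ω) (j : ℕ × Fin n) => seed j.1 j.2 o) (fun o k => coin k o) Pr)
    (hC : ∀ k i, Measurable (Function.uncurry (C k i))) (k : ℕ) :
    IndepFun
      (fun o => adianaIter q f ψ x₀ h₀ (fun k i => C k i (seed k i o)) (fun k => coin k o) k)
      (fun o => (fun i => seed k i o, coin k o)) Pr := by
  obtain ⟨Φ, hΦ, he⟩ := P.exists_measurable_adianaIter_eq hη hL x₀ h₀ hC k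
  have hs' : IndepFun
      (fun o (j : (Finset.range k ×ˢ Finset.univ : Finset (ℕ × Fin n))) => seed j.1.1 j.1.2 o)
      (fun o i => seed k i o) Pr := by
    have := hs.indepFun_finset (Finset.range k ×ˢ Finset.univ) ({k} ×ˢ Finset.univ)
      (by
        rw [Finset.disjoint_left]
        rintro ⟨a, b⟩ h1 h2
        simp only [Finset.mem_product, Finset.mem_range, Finset.mem_singleton, Finset.mem_univ,
          and_true] at h1 h2
        omega) (fun j => hseed _ _)
    have hm : ∀ i : Fin n, (k, i) ∈ ({k} ×ˢ Finset.univ : Finset (ℕ × Fin n)) := fun i => by simp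
    exact this.comp (φ := id)
      (ψ := fun (t : ({k} ×ˢ Finset.univ : Finset (ℕ × Fin n)) → S) i => t ⟨(k, i), hm i⟩)
      measurable_id (measurable_pi_lambda _ fun i => measurable_pi_apply _)
  have hc' : IndepFun (fun o (j : Finset.range k) => coin j o) (coin k) Pr := by
    have := hc.indepFun_finset (Finset.range k) {k} (by simp) hcoin
    exact this.comp (φ := id) (ψ := fun (t : ({k} : Finset ℕ) → Bool) => t ⟨k, by simp⟩)
      measurable_id (measurable_pi_apply _)
  have hsc' := hsc.comp
    (φ := fun t : ℕ × Fin n → S =>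
      (fun (j : (Finset.range k ×ˢ Finset.univ : Finset (ℕ × Fin n))) => t j.1, fun i => t (k, i)))
    (ψ := fun t : ℕ → Bool => (fun j : Finset.range k => t j, t k))
    (by fun_prop) (by fun_prop)
  -- The four variables are the past seeds, the present seeds, the past coins and the present coin.
  have := hs'.prodMk_prodMk_of_indepFun (measurable_pi_lambda _ fun j => hseed _ _)
    (measurable_pi_lambda _ fun j => hseed _ _) (measurable_pi_lambda _ fun j => hcoin _)
    (hcoin k) hc' hsc'
  simp_rw [fun o => he (fun k i => seed k i o) fun k => coin k o]
  exact this.comp hΦ measurable_id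

theorem AdianaState.Valid.iter (P : IsCompositeProblem f ψ L μ xs)
    (hη : 0 < q.η) (hL : q.η * L ≤ 1 / 2) {x₀ : Vec d} (hx : ψ x₀ ≠ ⊤) (h₀ : Fin n → Vec d)
    (c : ℕ → Fin n → Vec d → Vec d) (b : ℕ → Bool) (k : ℕ) :
    (adianaIter q f ψ x₀ h₀ c b k).Valid ψ := by
  induction k with
  | zero => exact AdianaState.Valid.init hx h₀
  | succ k ih => exact ih.step P.proper (P.isProx_prox hη hL) _ _

/-- Linear convergence of ADIANA. -/
theorem IsCompositeProblem.lintegral_lyapunov_le (P : IsCompositeProblem f ψ L μ xs)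
    (hq : q.Admissible n ω L μ) {x₀ : Vec d} (hx : ψ x₀ ≠ ⊤) (h₀ : Fin n → Vec d)
    (hseed : ∀ k i, Measurable (seed k i)) (hcoin : ∀ k, Measurable (coin k))
    (hs : iIndepFun (fun (j : ℕ × Fin n) => seed j.1 j.2) Pr) (hc : iIndepFun coin Pr)
    (hsc : IndepFun (fun (o : Ω) (j : ℕ × Fin n) => seed j.1 j.2 o) (fun o k => coin k o) Pr)
    (hp : ∀ k, Pr {o | coin k o = true} = ENNReal.ofReal q.p)
    (hC : ∀ k i, IsCompressor ω (Pr.map (seed k i)) (C k i)) (k : ℕ) :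
    ∫⁻ o, ENNReal.ofReal (lyapunov q ω f ψ xs
        (adianaIter q f ψ x₀ h₀ (fun k i => C k i (seed k i o)) (fun k => coin k o) k)) ∂Pr
      ≤ ENNReal.ofReal ((1 - q.rate μ) ^ k * adianaInitError q ω f ψ x₀ h₀ xs) := by
  have hCm := fun k i => (hC k i).measurable
  have hρ : 0 ≤ 1 - q.rate μ := by
    have := AdianaParams.Admissible.rate_le_α (q := q) (μ := μ)
    linarith [hq.α_le_one]
  induction k with
  | zero => simp [adianaIter, lyapunov_init]
  | succ k ih =>
    set T : Ω → AdianaState d n := fun o =>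
      adianaIter q f ψ x₀ h₀ (fun k i => C k i (seed k i o)) (fun k => coin k o) k with hT
    set X : Ω → (Fin n → S) × Bool := fun o => (fun i => seed k i o, coin k o) with hX
    set H : AdianaState d n × ((Fin n → S) × Bool) → ENNReal := fun t =>
      ENNReal.ofReal (lyapunov q ω f ψ xs
        (adianaStep q f ψ (fun i => C k i (t.2.1 i)) t.2.2 t.1)) with hH
    have hHm : Measurable H := (P.measurable_lyapunov.comp
      (P.measurable_adianaStep hq.η_pos hq.η_mul_L_le (hCm k))).ennreal_ofReal
    have hTm : Measurable T :=
      P.measurable_adianaIter hq.η_pos hq.η_mul_L_le x₀ h₀ hseed hcoin hCm k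
    have hXm : Measurable X := Measurable.prodMk (measurable_pi_lambda _ fun i => hseed k i) (hcoin k)
    have hTX : IndepFun T X Pr :=
      P.indepFun_adianaIter hq.η_pos hq.η_mul_L_le x₀ h₀ hseed hcoin hs hc hsc hCm k
    have hTX' := (indepFun_iff_map_prod_eq_prod_map_map hTm.aemeasurable hXm.aemeasurable).1 hTX
    have := Measure.isProbabilityMeasure_map (μ := Pr) hXm.aemeasurable
    have hsk : iIndepFun (seed k) Pr :=
      hs.precomp (g := fun i : Fin n => (k, i)) (fun i j hij => by simpa using hij)
    have hsck : IndepFun (fun o i => seed k i o) (coin k) Pr :=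
      hsc.comp (φ := fun (t : ℕ × Fin n → S) i => t (k, i)) (ψ := fun t : ℕ → Bool => t k)
        (by fun_prop) (by fun_prop)
    -- By independence the state can be frozen while the fresh randomness is integrated. With
    -- nonnegative integrals Tonelli applies without prior integrability of the Lyapunov function.
    calc ∫⁻ o, H (T o, X o) ∂Pr
        = ∫⁻ t, H t ∂((Pr.map T).prod (Pr.map X)) := by
          rw [← hTX', lintegral_map hHm (hTm.prodMk hXm)]
      _ = ∫⁻ o', ∫⁻ o, H (T o', X o) ∂Pr ∂Pr := by
          rw [lintegral_prod _ hHm.aemeasurable, lintegral_map hHm.lintegral_prod_right' hTm]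
          refine lintegral_congr fun o' => ?_
          exact lintegral_map (f := fun x => H (T o', x)) (hHm.comp measurable_prodMk_left) hXm
      _ ≤ ∫⁻ o', ENNReal.ofReal (1 - q.rate μ) * ENNReal.ofReal (lyapunov q ω f ψ xs (T o')) ∂Pr := by
          refine lintegral_mono fun o' => ?_
          rw [← ENNReal.ofReal_mul hρ]
          exact (AdianaState.Valid.iter P hq.η_pos hq.η_mul_L_le hx h₀ _ _ k).lintegral_lyapunov_step_le
            P hq (hseed k) (hcoin k) hsk hsck (hp k) (hC k)
      _ = ENNReal.ofReal (1 - q.rate μ) * ∫⁻ o', ENNReal.ofReal (lyapunov q ω f ψ xs (T o')) ∂Pr :=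
          lintegral_const_mul _ (P.measurable_lyapunov.comp hTm).ennreal_ofReal
      _ ≤ ENNReal.ofReal (1 - q.rate μ)
          * ENNReal.ofReal ((1 - q.rate μ) ^ k * adianaInitError q ω f ψ x₀ h₀ xs) := by gcongr
      _ = _ := by rw [← ENNReal.ofReal_mul hρ, pow_succ']; ring_nf

end Independence

/-! ### The contraction rate for the chosen parameters. -/

section Parameters

variable {n : ℕ} {ω L μ : ℝ}

theorem adianaP_pos (hω : 0 ≤ ω) : 0 < adianaP n ω := by
  rw [adianaP]
  split_ifs
  · exact one_pos
  · have : 0 < max 1 (√((n : ℝ) / (32 * ω)) - 1) := lt_max_of_lt_left one_pos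
    positivity

theorem adianaP_le_one : adianaP n ω ≤ 1 := by
  rw [adianaP]
  split_ifs
  · exact le_rfl
  · exact min_le_left _ _

theorem adianaEta_pos (hn : 0 < n) (hω : 0 ≤ ω) (hL : 0 < L) : 0 < adianaEta n ω L := by
  have h1 : (0 : ℝ) < n := Nat.cast_pos.2 hn
  have h2 := adianaP_pos (n := n) hω
  rw [adianaEta]
  split_ifs with h
  · positivity
  · have : 0 < ω := lt_of_le_of_ne hω (Ne.symm h)
    positivity

theorem adianaEta_mul_le (hL : 0 < L) : adianaEta n ω L * L ≤ 1 / 2 := by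
  have h : adianaEta n ω L ≤ 1 / (2 * L) := by
    rw [adianaEta]
    split_ifs
    · exact le_rfl
    · exact min_le_left _ _
  calc adianaEta n ω L * L ≤ 1 / (2 * L) * L := by gcongr
    _ = 1 / 2 := by field_simp

theorem adianaTheta₁_pos (hn : 0 < n) (hω : 0 ≤ ω) (hL : 0 < L) (hμ : 0 < μ) :
    0 < adianaTheta₁ n ω L μ := by
  have h1 := adianaP_pos (n := n) hω
  have h2 := adianaEta_pos hn hω hL
  rw [adianaTheta₁]
  positivity

theorem admissible_adianaParams (hn : 0 < n) (hω : 0 ≤ ω) (hL : 0 < L) (hμ : 0 < μ) :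
    (adianaParams n ω L μ).Admissible n ω L μ where
  n_pos := hn
  L_pos := hL
  μ_pos := hμ
  ω_nonneg := hω
  η_pos := adianaEta_pos hn hω hL
  θ₁_pos := adianaTheta₁_pos hn hω hL hμ
  θ₁_le := min_le_left _ _
  θ₂_eq := rfl
  p_pos := adianaP_pos hω
  p_le := adianaP_le_one
  α_mul := div_mul_cancel₀ _ (by positivity)
  γ_mul := div_mul_cancel₀ _ (by
    have h1 := adianaTheta₁_pos hn hω hL hμ
    have h2 := mul_pos (adianaEta_pos hn hω hL) hμ
    positivity)
  β_eq := rfl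
  η_mul_L_le := adianaEta_mul_le hL
  variance_le := by
    change 64 * ω * (2 * adianaP n ω * (ω + 1) + 1) ^ 2 * L * adianaEta n ω L ≤ n
    by_cases h : ω = 0
    · rw [h]; simp
    · have h1 : 0 < ω := lt_of_le_of_ne hω (Ne.symm h)
      have h2 := adianaP_pos (n := n) hω
      have h3 : adianaEta n ω L ≤ n / (64 * ω * (2 * adianaP n ω * (ω + 1) + 1) ^ 2 * L) := by
        rw [adianaEta, if_neg h]; exact min_le_right _ _
      rw [le_div_iff₀ (by positivity)] at h3
      linarith

theorem omega_add_one_le_adianaRate (hn : 0 < n) (hω : 0 ≤ ω) (hμ : 0 < μ) (hμL : μ ≤ L) :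
    ω + 1 ≤ 2 * adianaRate n ω L μ := by
  have h1 : (1 : ℝ) ≤ n := Nat.one_le_cast.2 hn
  rw [adianaRate]
  split_ifs with h
  · have : 0 ≤ ω * √(L / (n * μ)) := by positivity
    linarith
  · have h2 : 1 ≤ √(L / μ) := by
      rw [Real.one_le_sqrt, one_le_div hμ]; exact hμL
    have : 0 ≤ √(√(ω / n) * (ω * L / μ)) := by positivity
    linarith

theorem inv_le_adianaP (hω : 0 ≤ ω) : 1 / (2 * (1 + ω)) ≤ adianaP n ω := by
  rw [adianaP]
  split_ifs with h
  · rw [h]; norm_num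
  · refine le_min ?_ ?_
    · rw [div_le_one (by positivity)]; linarith
    · gcongr; exact le_max_left _ _

/-- In this regime both minima are explicit: `p = 1/(2(1+ω))` and `2p(ω+1)+1 = 2`, so `η =
n/(256ωL)` and `pημ` is of order `nμ/(ω²L)`. The constant `6400 = 80²` serves both regimes and has a
convenient square root. -/
theorem one_le_adianaRate_sq_mul_of_le (hn : 0 < n) (hL : 0 < L) (hμ : 0 < μ) (h : (n : ℝ) ≤ ω) :
    1 ≤ 6400 * (adianaRate n ω L μ ^ 2 * (adianaP n ω * adianaEta n ω L * μ)) := by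
  have h1 : (1 : ℝ) ≤ n := Nat.one_le_cast.2 hn
  have hω : 1 ≤ ω := h1.trans h
  have hn0 : (0 : ℝ) < n := by linarith
  have hω0 : 0 < ω := by linarith
  have hp : adianaP n ω = 1 / (2 * (1 + ω)) := by
    have e : max 1 (√((n : ℝ) / (32 * ω)) - 1) = 1 := by
      refine max_eq_left ?_
      have : √((n : ℝ) / (32 * ω)) ≤ 1 := by
        rw [Real.sqrt_le_one, div_le_one (by positivity)]; linarith
      linarith
    rw [adianaP, if_neg hω0.ne', e]
    refine min_eq_right ?_
    rw [div_le_one (by positivity)]; linarith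
  have hη : adianaEta n ω L = n / (256 * ω * L) := by
    have e : 2 * adianaP n ω * (ω + 1) + 1 = 2 := by rw [hp]; field_simp; ring
    rw [adianaEta, if_neg hω0.ne', e]
    have e' : 64 * ω * 2 ^ 2 * L = 256 * ω * L := by ring
    rw [e']
    refine min_eq_right ?_
    rw [div_le_div_iff₀ (by positivity) (by positivity)]
    nlinarith
  have hr : ω ^ 2 * (L / (n * μ)) ≤ adianaRate n ω L μ ^ 2 := by
    have e : ω ^ 2 * (L / (n * μ)) = (ω * √(L / (n * μ))) ^ 2 := by
      rw [mul_pow, Real.sq_sqrt (by positivity)]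
    rw [e, adianaRate, if_pos h]
    gcongr
    linarith
  have ht : n * μ / (1024 * ω ^ 2 * L) ≤ adianaP n ω * adianaEta n ω L * μ := by
    rw [hp, hη]
    have : 1 / (2 * (1 + ω)) * (n / (256 * ω * L)) * μ = n * μ / (512 * (1 + ω) * ω * L) := by
      field_simp; ring
    have h2 : 512 * (1 + ω) * ω * L ≤ 1024 * ω ^ 2 * L := by
      have h3 : 512 * (1 + ω) ≤ 1024 * ω := by linarith
      calc 512 * (1 + ω) * ω * L ≤ 1024 * ω * ω * L := by gcongr
        _ = 1024 * ω ^ 2 * L := by ring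
    rw [this]
    exact div_le_div_of_nonneg_left (by positivity) (by positivity) h2
  calc (1 : ℝ) ≤ 6400 * (ω ^ 2 * (L / (n * μ)) * (n * μ / (1024 * ω ^ 2 * L))) := by
        have : ω ^ 2 * (L / (n * μ)) * (n * μ / (1024 * ω ^ 2 * L)) = 1 / 1024 := by field_simp
        rw [this]; norm_num
    _ ≤ _ := by gcongr

theorem one_le_adianaRate_sq_mul_of_lt (hL : 0 < L) (hμ : 0 < μ)
    (hω : 0 ≤ ω) (h : ω < n) :
    1 ≤ 6400 * (adianaRate n ω L μ ^ 2 * (adianaP n ω * adianaEta n ω L * μ)) := by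
  have hn0 : (0 : ℝ) < n := lt_of_le_of_lt hω h
  set s := √(ω / n) with hs
  -- The square of the sum of the two root terms dominates the sum of their squares, which is this
  -- product.
  have hr : L / μ * (1 + ω * s) ≤ adianaRate n ω L μ ^ 2 := by
    rw [adianaRate, if_neg (not_le.2 h), ← hs]
    have e1 : √(L / μ) ^ 2 = L / μ := Real.sq_sqrt (by positivity)
    have e2 : √(s * (ω * L / μ)) ^ 2 = s * (ω * L / μ) := Real.sq_sqrt (by positivity)
    have e3 : L / μ * (1 + ω * s) = √(L / μ) ^ 2 + √(s * (ω * L / μ)) ^ 2 := by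
      rw [e1, e2]; ring
    rw [e3]
    have := Real.sqrt_nonneg (L / μ)
    have := Real.sqrt_nonneg (s * (ω * L / μ))
    calc √(L / μ) ^ 2 + √(s * (ω * L / μ)) ^ 2 ≤ (√(L / μ) + √(s * (ω * L / μ))) ^ 2 := by nlinarith
      _ ≤ _ := by gcongr; linarith
  have hωs : 0 < 1 + ω * s := by
    have := Real.sqrt_nonneg (ω / n)
    positivity
  suffices hpη : 1 / (24 * (1 + ω * s)) * (1 / (256 * L)) ≤ adianaP n ω * adianaEta n ω L by
    calc (1 : ℝ) ≤ 6400 * (L / μ * (1 + ω * s)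
          * (1 / (24 * (1 + ω * s)) * (1 / (256 * L)) * μ)) := by
          have : L / μ * (1 + ω * s) * (1 / (24 * (1 + ω * s)) * (1 / (256 * L)) * μ)
              = 1 / 6144 := by field_simp; norm_num
          rw [this]; norm_num
      _ ≤ _ := by gcongr
  by_cases h0 : ω = 0
  · rw [adianaP, adianaEta, if_pos h0, if_pos h0, h0]
    rw [zero_mul, add_zero, mul_one, one_mul, div_mul_div_comm, one_mul]
    exact one_div_le_one_div_of_le (by positivity) (by linarith)
  have hω0 : 0 < ω := lt_of_le_of_ne hω (Ne.symm h0)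
  have hs1 : s ≤ 1 := by
    rw [hs, Real.sqrt_le_one, div_le_one hn0]; exact h.le
  have hs0 : 0 < s := Real.sqrt_pos.2 (by positivity)
  set T := √((n : ℝ) / (32 * ω)) with hT
  have hT2 : T ^ 2 = n / (32 * ω) := Real.sq_sqrt (by positivity)
  have hT0 : 0 ≤ T := Real.sqrt_nonneg _
  -- `s * T = 1/√32` whatever `n` and `ω` are, and `√32 < 6`.
  have hTs : 1 ≤ 6 * (s * T) := by
    have e : (s * T) ^ 2 = 1 / 32 := by
      rw [mul_pow, hT2, hs, Real.sq_sqrt (by positivity)]; field_simp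
    have : 0 ≤ s * T := by positivity
    by_contra hlt
    push Not at hlt
    nlinarith
  set m := max 1 (T - 1) with hm
  have hm1 : 1 ≤ m := le_max_left _ _
  have hmT : T / 2 ≤ m := by
    rcases le_total T 2 with h2 | h2
    · linarith
    · have := le_max_right 1 (T - 1)
      rw [← hm] at this
      linarith
  have hpd : adianaP n ω = min 1 (m / (2 * (1 + ω))) := by rw [adianaP, if_neg h0]
  have hp : 1 / (24 * (1 + ω * s)) ≤ adianaP n ω := by
    rw [hpd]
    refine le_min ?_ ?_
    · have : 0 ≤ ω * s := by positivity
      rw [div_le_one (by positivity)]; linarith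
    · rw [div_le_div_iff₀ (by positivity) (by positivity)]
      have h3 : s * (T / 2) ≤ s * m := by gcongr
      have h4 : 1 ≤ 12 * (s * m) := by linarith
      have h5 : 0 ≤ (12 * (s * m) - 1) * ω := mul_nonneg (by linarith) hω
      nlinarith
  have hη : 1 / (256 * L) ≤ adianaEta n ω L := by
    rw [adianaEta, if_neg h0]
    refine le_min ?_ ?_
    · gcongr; norm_num
    · have hu : 2 * adianaP n ω * (ω + 1) + 1 ≤ m + 1 := by
        have : adianaP n ω ≤ m / (2 * (1 + ω)) := by rw [hpd]; exact min_le_right _ _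
        rw [le_div_iff₀ (by positivity)] at this
        linarith
      have hu0 : 0 < 2 * adianaP n ω * (ω + 1) + 1 := by
        have := adianaP_pos (n := n) hω
        positivity
      have hu2 : (2 * adianaP n ω * (ω + 1) + 1) ^ 2 ≤ (m + 1) ^ 2 := by gcongr
      -- The `-1` in the definition of `p` is for this: either `m + 1 = 2`, or `m + 1 = T`, whose
      -- square is `n/(32ω)`. Hence `η` stays of order `1/L`.
      have hm2 : 64 * ω * (m + 1) ^ 2 ≤ 256 * n := by
        rcases max_choice 1 (T - 1) with h2 | h2
        · rw [hm, h2]; linarith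
        · rw [hm, h2, sub_add_cancel, hT2]
          have : 64 * ω * (n / (32 * ω)) = 2 * n := by field_simp; norm_num
          rw [this]; linarith
      rw [div_le_div_iff₀ (by positivity) (by positivity)]
      have h3 : 64 * ω * (2 * adianaP n ω * (ω + 1) + 1) ^ 2 ≤ 256 * n :=
        le_trans (by gcongr) hm2
      have := mul_le_mul_of_nonneg_right h3 hL.le
      linarith
  have := adianaP_pos (n := n) hω
  gcongr

/-- With `t = √(pημ)` one has `θ₁ = min(1/4, t/p)`, so every entry of `rate` is at least a constant
multiple of `1/adianaRate` once `adianaRate` dominates `1/t`, `1/p` and `ω + 1`. -/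
theorem one_le_mul_adianaRate_mul_rate (hn : 0 < n) (hω : 0 ≤ ω) (hμ : 0 < μ) (hμL : μ ≤ L) :
    1 ≤ 400 * adianaRate n ω L μ * (adianaParams n ω L μ).rate μ := by
  have hL : 0 < L := hμ.trans_le hμL
  have ha := omega_add_one_le_adianaRate hn hω hμ hμL
  have hb := inv_le_adianaP (n := n) hω
  have hp := adianaP_pos (n := n) hω
  have hp1 := adianaP_le_one (n := n) (ω := ω)
  have hη := adianaEta_pos hn hω hL
  have hc : 1 ≤ 6400 * (adianaRate n ω L μ ^ 2 * (adianaP n ω * adianaEta n ω L * μ)) := by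
    rcases le_or_gt (n : ℝ) ω with h | h
    · exact one_le_adianaRate_sq_mul_of_le hn hL hμ h
    · exact one_le_adianaRate_sq_mul_of_lt hL hμ hω h
  set r := adianaRate n ω L μ
  set p := adianaP n ω
  set η := adianaEta n ω L
  have hr : 0 < r := by linarith
  set t := √(p * η * μ) with ht
  have ht0 : 0 < t := Real.sqrt_pos.2 (by positivity)
  have ht2 : t ^ 2 = p * η * μ := Real.sq_sqrt (by positivity)
  have hrt : 1 ≤ 80 * (r * t) := by
    rw [← ht2] at hc
    have : 0 < r * t := by positivity
    by_contra hlt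
    push Not at hlt
    nlinarith
  have hrp : 1 ≤ 4 * (r * p) := by
    rw [div_le_iff₀ (by positivity)] at hb
    nlinarith
  have hθt : √(η * μ / p) = t / p := by
    rw [← Real.sqrt_sq (show 0 ≤ t / p by positivity), div_pow, ht2]
    congr 1
    field_simp
  have hθ : adianaTheta₁ n ω L μ = min (1 / 4) (t / p) := by rw [adianaTheta₁, hθt]
  have hθ0 := adianaTheta₁_pos hn hω hL hμ
  set θ := adianaTheta₁ n ω L μ
  have hpθ : 1 ≤ 80 * (r * (p * θ)) := by
    have : p * θ = min (p / 4) t := by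
      rw [hθ, mul_min_of_nonneg _ _ hp.le, mul_div_cancel₀ _ hp.ne']
      ring_nf
    rw [this]
    rcases min_choice (p / 4) t with h | h <;> rw [h] <;> linarith
  have hγ : 1 ≤ 200 * r * (adianaGamma n ω L μ * μ) := by
    have h1 : θ ≤ t / p := by rw [hθ]; exact min_le_right _ _
    have h2 : p * θ ≤ t := by rwa [le_div_iff₀ hp, mul_comm] at h1
    have e : adianaGamma n ω L μ * μ = η * μ / (2 * (θ + η * μ)) := by
      rw [adianaGamma, div_mul_eq_mul_div]
    rw [e, mul_div_assoc', one_le_div (by positivity)]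
    -- Since `pθ ≤ t ≤ 80rt²` and `t² = pημ`, the denominator `2(θ + ημ)` is `O(r)` times the
    -- numerator `ημ`.
    have h3 : θ ≤ 80 * r * (η * μ) := by
      have h4 : p * θ ≤ p * (80 * r * (η * μ)) := by
        calc p * θ ≤ t * 1 := by linarith
          _ ≤ t * (80 * (r * t)) := by gcongr
          _ = p * (80 * r * (η * μ)) := by linear_combination 80 * r * ht2
      exact le_of_mul_le_mul_left h4 hp
    have h5 : 1 ≤ 2 * r := by linarith
    have h6 : 0 < η * μ := by positivity
    nlinarith
  rw [AdianaParams.rate]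
  have hK : 0 < 400 * r := by positivity
  rw [mul_min_of_nonneg _ _ hK.le, mul_min_of_nonneg _ _ hK.le, mul_min_of_nonneg _ _ hK.le]
  change 1 ≤ min (min (400 * r * (adianaGamma n ω L μ * μ)) (400 * r * (θ / 2)))
    (min (400 * r * (p * θ / (1 + θ))) (400 * r * (1 / (ω + 1) / 4)))
  have hθ1 : θ ≤ 1 / 4 := min_le_left _ _
  refine le_min (le_min ?_ ?_) (le_min ?_ ?_)
  · linarith
  · have : p * θ ≤ 1 * θ := by gcongr
    have : r * (p * θ) ≤ r * (1 * θ) := by gcongr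
    linarith
  · rw [mul_div_assoc', one_le_div (by positivity)]
    linarith
  · rw [div_div, mul_one_div, one_le_div (by positivity)]
    linarith

end Parameters

/-! ### The iteration bound. -/

theorem theorem4 :
    ∃ K : ℝ, 0 < K ∧
    ∀ (d n : ℕ) (L μ ω : ℝ), 0 < n → 0 < L → 0 < μ → 0 ≤ ω →
    -- the problem
    ∀ (f : Fin n → Vec d → ℝ) (ψ : Vec d → EReal),
      (∀ i, ConvexOn ℝ Set.univ (f i)) →
      (∀ i, IsLSmooth L (f i)) →
      StrongConvexOn Set.univ μ (avgLoss f) →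
      IsProperClosedConvex ψ →
    ∀ xs : Vec d, (∀ x, objective f ψ xs ≤ objective f ψ x) →
    -- initial point and initial shifts
    ∀ (x₀ : Vec d) (h₀ : Fin n → Vec d), ψ x₀ ≠ ⊤ →
    -- randomness: seeds of the compressors and coin flips
    ∀ (Ω : Type*) [MeasurableSpace Ω] (Pr : Measure Ω) [IsProbabilityMeasure Pr]
      (S : Type*) [MeasurableSpace S]
      (seed : ℕ → Fin n → Ω → S) (coin : ℕ → Ω → Bool)
      (C : ℕ → Fin n → S → Vec d → Vec d),
      (∀ k i, Measurable (seed k i)) →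
      (∀ k, Measurable (coin k)) →
      iIndepFun (fun (j : ℕ × Fin n) => seed j.1 j.2) Pr →
      iIndepFun coin Pr →
      IndepFun (fun (s : Ω) (j : ℕ × Fin n) => seed j.1 j.2 s) (fun s k => coin k s) Pr →
      (∀ k, Pr {s | coin k s = true} = ENNReal.ofReal (adianaParams n ω L μ).p) →
      (∀ k i, IsCompressor ω (Pr.map (seed k i)) (C k i)) →
    -- iteration bound
    ∀ (ε : ℝ), 0 < ε → ∀ k : ℕ,
      K * adianaRate n ω L μ *
          Real.log (adianaInitError (adianaParams n ω L μ) ω f ψ x₀ h₀ xs / ε) ≤ k →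
      Integrable (fun s => ‖(adianaIter (adianaParams n ω L μ) f ψ x₀ h₀
        (fun k i => C k i (seed k i s)) (fun k => coin k s) k).z - xs‖ ^ 2) Pr ∧
      ∫ s, ‖(adianaIter (adianaParams n ω L μ) f ψ x₀ h₀
        (fun k i => C k i (seed k i s)) (fun k => coin k s) k).z - xs‖ ^ 2 ∂Pr ≤ ε := by
  refine ⟨400, by norm_num, ?_⟩
  intro d n L μ ω hn hL hμ hω f ψ hconv hsmooth hstrong hψ xs hmin x₀ h₀ hx₀ Ω _ Pr _ S _ seed coin C
    hseed hcoin hs hc hsc hp hC ε hε k hk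
  -- In dimension zero `μ ≤ L` can fail, but there all points coincide.
  rcases Nat.eq_zero_or_pos d with rfl | hd
  · have e : ∀ v : Vec 0, ‖v - xs‖ ^ 2 = 0 := fun v => by
      rw [Subsingleton.elim v xs, sub_self, norm_zero, zero_pow two_ne_zero]
    simp only [e]
    exact ⟨integrable_const _, by simpa using hε.le⟩
  have P : IsCompositeProblem f ψ L μ xs := ⟨hn, hconv, hsmooth, hstrong, hψ, hmin⟩
  have hq := admissible_adianaParams hn hω hL hμ
  have hrate := one_le_mul_adianaRate_mul_rate hn hω hμ (P.μ_le_L hd)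
  set q := adianaParams n ω L μ
  set T : Ω → AdianaState d n := fun s =>
    adianaIter q f ψ x₀ h₀ (fun k i => C k i (seed k i s)) (fun k => coin k s) k with hT
  have hTm : Measurable T := P.measurable_adianaIter hq.η_pos hq.η_mul_L_le x₀ h₀ hseed hcoin
    (fun k i => (hC k i).measurable) k
  have hTv : ∀ s, (T s).Valid ψ := fun s =>
    AdianaState.Valid.iter P hq.η_pos hq.η_mul_L_le hx₀ h₀ _ _ k
  have hm : Measurable fun s => ‖(T s).z - xs‖ ^ 2 :=
    ((AdianaState.measurable_z.comp hTm).sub_const xs).norm.pow_const 2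
  set Ψ := adianaInitError q ω f ψ x₀ h₀ xs with hΨ
  have hΨ0 : 0 ≤ Ψ := le_trans (sq_nonneg _) ((AdianaState.Valid.init hx₀ h₀).lyapunov_ge P hq)
  set ρ := q.rate μ
  have hρ0 : 0 ≤ ρ := hq.rate_nonneg
  have hρ1 : 0 ≤ 1 - ρ := by
    have := AdianaParams.Admissible.rate_le_α (q := q) (μ := μ)
    linarith [hq.α_le_one]
  have hdecay : (1 - ρ) ^ k * Ψ ≤ ε := by
    -- If `Ψ ≤ ε`, which includes `Ψ = 0`, where the default `Real.log 0 = 0` applies, every `k`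
    -- works and the hypothesis on `k` plays no role.
    rcases le_or_gt Ψ ε with h | h
    · exact (mul_le_of_le_one_left hΨ0 (pow_le_one₀ hρ1 (by linarith))).trans h
    · have hΨpos : 0 < Ψ := hε.trans h
      have hlog : 0 ≤ Real.log (Ψ / ε) := Real.log_nonneg ((one_le_div hε).2 h.le)
      have h1 : Real.log (Ψ / ε) ≤ ρ * k := by
        have h2 := mul_le_mul_of_nonneg_left hk hρ0
        have h3 := mul_le_mul_of_nonneg_right hrate hlog
        linarith
      have h2 : (1 - ρ) ^ k ≤ ε / Ψ := by
        calc (1 - ρ) ^ k ≤ Real.exp (-ρ) ^ k := by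
              gcongr
              exact Real.one_sub_le_exp_neg ρ
          _ = Real.exp (-(ρ * k)) := by rw [← Real.exp_nat_mul]; ring_nf
          _ ≤ Real.exp (-Real.log (Ψ / ε)) := Real.exp_le_exp.2 (neg_le_neg h1)
          _ = ε / Ψ := by rw [← Real.log_inv, Real.exp_log (by positivity), inv_div]
      calc (1 - ρ) ^ k * Ψ ≤ ε / Ψ * Ψ := by gcongr
        _ = ε := div_mul_cancel₀ _ hΨpos.ne'
  have hbound : ∫⁻ s, ENNReal.ofReal (‖(T s).z - xs‖ ^ 2) ∂Pr ≤ ENNReal.ofReal ε :=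
    calc ∫⁻ s, ENNReal.ofReal (‖(T s).z - xs‖ ^ 2) ∂Pr
        ≤ ∫⁻ s, ENNReal.ofReal (lyapunov q ω f ψ xs (T s)) ∂Pr :=
          lintegral_mono fun s => ENNReal.ofReal_le_ofReal ((hTv s).lyapunov_ge P hq)
      _ ≤ ENNReal.ofReal ((1 - ρ) ^ k * Ψ) :=
          P.lintegral_lyapunov_le hq hx₀ h₀ hseed hcoin hs hc hsc hp hC k
      _ ≤ ENNReal.ofReal ε := ENNReal.ofReal_le_ofReal hdecay
  have hnn : 0 ≤ᵐ[Pr] fun s => ‖(T s).z - xs‖ ^ 2 := Filter.Eventually.of_forall fun s => sq_nonneg _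
  refine ⟨(lintegral_ofReal_ne_top_iff_integrable hm.aestronglyMeasurable hnn).1
    (ne_top_of_le_ne_top ENNReal.ofReal_ne_top hbound), ?_⟩
  rw [integral_eq_lintegral_of_nonneg_ae hnn hm.aestronglyMeasurable]
  exact ENNReal.toReal_le_of_le_ofReal hε.le hbound
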